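/- Setting. Let $\mathcal H$ be a complex Hilbert space with a complex conjugation $\mathcal C$ (an anti-linear isometry with $\mathcal C^2=\mathbf 1$). For bounded $A$ put $\overline A=\mathcal C A\mathcal C$ and $A^t=(\overline A)^*$. A symmetry operator is a real unitary $S=\overline S$ with $S^2=\mathbf 1$ (even) or $S^2=-\mathbf 1$ (odd) whose eigenspaces all have the same dimension; only non-zero eigenspaces count, so that $\pm\mathbf 1$ are even symmetry operators. For unitaries $U,F$ on $\mathcal H$ set, on $\mathcal H\oplus\mathcal H$ (with conjugation $\mathcal C\oplus\mathcal C$), $$P=\tfrac12\begin{pmatrix}\mathbf 1&U\\U^*&\mathbf 1\end{pmatrix},\qquad T=P\begin{pmatrix}F&0\\0&F\end{pmatrix}P+\mathbf 1-P .$$ For Fredholm $T$ let $\mathrm{Ind}(T)=\dim\ker T-\dim\ker T^*$ and $\mathrm{Ind}_2(T)=\dim\ker T \bmod 2$. Let $j\in\{1,3,5,7\}$ and $d\in\{2,4,6,8\}$. The pair $(U,F)$ is an index pairing with the symmetries $(j,d)$, given by symmetry operators $S,\Sigma$, if $U,F$ are unitary, $T$ is Fredholm, $[S,\Sigma]=0$,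 $[S,F]=0$, $[\Sigma\oplus\Sigma,P]=0$, and - $j=1$: $S^*\overline US=U$, $S^2=\mathbf 1$; $j=3$: $S^*U^tS=U$, $S^2=-\mathbf 1$; $j=5$: $S^*\overline US=U$, $S^2=-\mathbf 1$; $j=7$: $S^*U^tS=U$, $S^2=\mathbf 1$; - $d=2$: $\Sigma^*F^t\Sigma=F$, $\Sigma^2=\mathbf 1$; $d=4$: $\Sigma^*\overline F\Sigma=F$, $\Sigma^2=-\mathbf 1$; $d=6$: $\Sigma^*F^t\Sigma=F$, $\Sigma^2=-\mathbf 1$; $d=8$: $\Sigma^*\overline F\Sigma=F$, $\Sigma^2=\mathbf 1$. Proposition. Let $(U,F)$ be an index pairing with the symmetries $(j,d)$, given by $S,\Sigma$. Then $\mathrm{Ind}(T)=0$, and the $\mathbb Z_2$-index is as in the table | | $d=2$ | $d=4$ | $d=6$ | $d=8$ | |---|---|---|---|---| | $j=1$ | $0$ | $0$ | $0$ | O-$\mathbb Z_2$ | | $j=3$ | Q-$\mathbb Z_2$ | $0$ | $0$ | $0$ | | $j=5$ | $0$ | S-$\mathbb Z_2$ | $0$ | $0$ | | $j=7$ | $0$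 | $0$ | R-$\mathbb Z_2$ | $0$ | in the following sense. (a) At an entry $X$-$\mathbb Z_2$, $\mathrm{Ind}_2(T)$ is well-defined: it is constant along every norm-continuous path of index pairings $(U_t,F_t)$ with the symmetries $(j,d)$, given by the same $S,\Sigma$, that starts at $(U,F)$. It is of type $X$: writing $\Theta=\Sigma\oplus\Sigma$ and $\Phi=F\oplus F$, the operator $\Theta$ is a symmetry operator commuting with $P$, and there is a symmetry operator $R$ on $\mathcal H\oplus\mathcal H$ commuting with $\Theta$ and $\Phi$ such that - type O: $R^*\overline PR=\mathbf 1-P$, $R^2=\mathbf 1$, $\Theta^*\overline\Phi\Theta=\Phi$, $\Theta^2=\mathbf 1$; - type S: $R^*\overline PR=\mathbf 1-P$, $R^2=-\mathbf 1$, $\Theta^*\overline\Phi\Theta=\Phi$, $\Theta^2=-\mathbf 1$; - type R: $R^*\overline PR=P$, $R^2=\mathbf 1$, $\Theta^*\Phi^t\Theta=\Phi$, $\Theta^2=-\mathbf 1$; - type Q: $R^*\overline PR=P$, $R^2=-\mathbf 1$, $\Theta^*\Phi^t\Theta=\Phi$, $\Theta^2=\mathbf 1$. (b) At an entry $0$ the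 $\mathbb Z_2$-index is trivial: there are $n\ge 0$, operators $s,\sigma,u$ on $\mathbb C^n$ and a norm-continuous path $(U_t,F_t)_{t\in[0,1]}$ of index pairings on $\mathcal H\oplus\mathbb C^n$ (with conjugation $\mathcal C$ plus the standard one) with the symmetries $(j,d)$, given by $S\oplus s,\ \Sigma\oplus\sigma$, such that $(U_0,F_0)=(U\oplus u,F\oplus\mathbf 1)$, so that the pairing operator at $t=0$ is, up to reordering summands, $T\oplus\mathbf 1$, and such that the pairing operator at $t=1$ has vanishing $\mathrm{Ind}_2$. -/

import Mathlib

noncomputable section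

namespace FUPairing

/-- A complex conjugation on a complex Hilbert space: an anti-linear isometry squaring to `1`. -/
structure ComplexConj (H : Type*) [NormedAddCommGroup H] [InnerProductSpace ℂ H] where
  toMap : H →ₗᵢ⋆[ℂ] H
  involutive : ∀ v, toMap (toMap v) = v

/-- The Hilbert space direct sum `H ⊕ K`. -/
abbrev DSum (H K : Type*) := WithLp 2 (H × K)

section Operators

variable {H K : Type*} [NormedAddCommGroup H] [InnerProductSpace ℂ H]
  [NormedAddCommGroup K] [InnerProductSpace ℂ K]

/-- The operator `(a b; c d)` on `H ⊕ K`. -/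
def blockOp (a : H →L[ℂ] H) (b : K →L[ℂ] H) (c : H →L[ℂ] K) (d : K →L[ℂ] K) :
    DSum H K →L[ℂ] DSum H K :=
  ((WithLp.prodContinuousLinearEquiv 2 ℂ H K).symm : H × K →L[ℂ] DSum H K) ∘L
    ((a ∘L WithLp.fstL 2 ℂ H K + b ∘L WithLp.sndL 2 ℂ H K).prod
      (c ∘L WithLp.fstL 2 ℂ H K + d ∘L WithLp.sndL 2 ℂ H K))

/-- The block diagonal operator `a ⊕ d` on `H ⊕ K`. -/
def diagOp (a : H →L[ℂ] H) (d : K →L[ℂ] K) : DSum H K →L[ℂ] DSum H K :=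
  blockOp a 0 0 d

theorem blockOp_apply (a : H →L[ℂ] H) (b : K →L[ℂ] H) (c : H →L[ℂ] K) (d : K →L[ℂ] K)
    (x : H) (y : K) :
    blockOp a b c d (WithLp.toLp 2 (x, y)) = WithLp.toLp 2 (a x + b y, c x + d y) := rfl

/-- The complex conjugate operator `C A C`. -/
def ComplexConj.bar (C : ComplexConj H) (A : H →L[ℂ] H) : H →L[ℂ] H :=
  C.toMap.toContinuousLinearMap.comp (A.comp C.toMap.toContinuousLinearMap)

theorem ComplexConj.bar_apply (C : ComplexConj H) (A : H →L[ℂ] H) (v : H) :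
    C.bar A v = C.toMap (A (C.toMap v)) := rfl

/-- The complex conjugation `C ⊕ D` on `H ⊕ K`. -/
def ComplexConj.sum (C : ComplexConj H) (D : ComplexConj K) : ComplexConj (DSum H K) where
  toMap :=
    { toFun := fun x => WithLp.toLp 2 (C.toMap x.fst, D.toMap x.snd)
      map_add' := fun x y => by simp [← WithLp.toLp_add]
      map_smul' := fun r x => by
        simp [← WithLp.toLp_smul, C.toMap.map_smulₛₗ, D.toMap.map_smulₛₗ]
      norm_map' := fun x => by
        change ‖WithLp.toLp 2 (C.toMap x.fst, D.toMap x.snd)‖ = ‖x‖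
        simp [WithLp.prod_norm_eq_of_L2] }
  involutive := fun x => by
    have h1 := C.involutive x.fst
    have h2 := D.involutive x.snd
    change WithLp.toLp 2 (C.toMap (C.toMap x.fst), D.toMap (D.toMap x.snd)) = x
    rw [h1, h2]
    rfl

/-- The standard (entrywise) complex conjugation on `ℂⁿ`. -/
def stdConj (n : ℕ) : ComplexConj (EuclideanSpace ℂ (Fin n)) where
  toMap :=
    { toFun := fun x => WithLp.toLp 2 (fun i => (starRingEnd ℂ) (x i))
      map_add' := fun x y => by ext i; simp
      map_smul' := fun r x => by ext i; simp
      norm_map' := fun x => by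
        simp [EuclideanSpace.norm_eq] }
  involutive := fun x => by ext i; simp

variable [CompleteSpace H]

/-- The transpose `Aᵗ = (C A C)^*`. -/
def ComplexConj.transpose (C : ComplexConj H) (A : H →L[ℂ] H) : H →L[ℂ] H :=
  star (C.bar A)

/-- The parity of a symmetry operator. -/
inductive Parity
  | even
  | odd

/-- The square of a symmetry operator of given parity: `1` if even, `-1` if odd. -/
def Parity.square : Parity → (H →L[ℂ] H)
  | .even => 1
  | .odd => -1

/-- A symmetry operator: a real unitary with `S² = 1` (even) or `S² = -1` (odd) whose eigenspaces
all have the same (Hilbert space) dimension. Only actual eigenvalues count, so that `1` is an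
even symmetry. -/
structure IsSymmetry (C : ComplexConj H) (p : Parity) (S : H →L[ℂ] H) : Prop where
  real : C.bar S = S
  unitary : S ∈ unitary (H →L[ℂ] H)
  square : S * S = p.square
  eigenspaces : ∀ μ ν : ℂ,
    Module.End.HasEigenvalue (S : H →ₗ[ℂ] H) μ → Module.End.HasEigenvalue (S : H →ₗ[ℂ] H) ν →
      Nonempty (Module.End.eigenspace (S : H →ₗ[ℂ] H) μ ≃ₗᵢ[ℂ]
        Module.End.eigenspace (S : H →ₗ[ℂ] H) ν)

/-- `S^* (C A C) S = A`. -/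
def IsReal (C : ComplexConj H) (S A : H →L[ℂ] H) : Prop :=
  star S * C.bar A * S = A

/-- `S^* Aᵗ S = A`. -/
def IsSymmetric (C : ComplexConj H) (S A : H →L[ℂ] H) : Prop :=
  star S * C.transpose A * S = A

/-- `S^* (C P C) S = 1 - P`. -/
def IsLagrangian (C : ComplexConj H) (S P : H →L[ℂ] H) : Prop :=
  star S * C.bar P * S = 1 - P

/-- The compressed operator `P Φ P + 1 - P`. -/
def compressed (P Φ : H →L[ℂ] H) : H →L[ℂ] H :=
  P * Φ * P + 1 - P

/-- The Noether index `dim ker T - dim ker T^*` (of a Fredholm operator). -/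
def noetherIndex (T : H →L[ℂ] H) : ℤ :=
  (Module.finrank ℂ (T : H →ₗ[ℂ] H).ker : ℤ) -
    (Module.finrank ℂ ((star T : H →L[ℂ] H) : H →ₗ[ℂ] H).ker : ℤ)

/-- The secondary index `dim ker T mod 2` (of a Fredholm operator). -/
def index₂ (T : H →L[ℂ] H) : ZMod 2 :=
  (Module.finrank ℂ (T : H →ₗ[ℂ] H).ker : ZMod 2)

/-- The operator `P = ½ (1 U; U^* 1)` on `H ⊕ H`, a projection when `U` is unitary. -/
def doubledProj (U : H →L[ℂ] H) : DSum H H →L[ℂ] DSum H H :=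
  (1 / 2 : ℂ) • blockOp 1 U (star U) 1

/-- The doubled pairing `T = P (F ⊕ F) P + 1 - P` of two unitaries, `P = ½ (1 U; U^* 1)`. -/
def pairingOp (U F : H →L[ℂ] H) : DSum H H →L[ℂ] DSum H H :=
  compressed (doubledProj U) (diagOp F F)

/-- The row label `j ∈ {1, 3, 5, 7}`. -/
inductive Row
  | j1
  | j3
  | j5
  | j7

/-- The column label `d ∈ {2, 4, 6, 8}`. -/
inductive Col
  | d2
  | d4
  | d6
  | d8

/-- The parity of `S` in row `j`. -/
def Row.parity : Row → Parity
  | .j1 => .even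
  | .j3 => .odd
  | .j5 => .odd
  | .j7 => .even

/-- The relation between `S` and `U` in row `j`. -/
def Row.Rel (C : ComplexConj H) (S U : H →L[ℂ] H) : Row → Prop
  | .j1 => IsReal C S U
  | .j3 => IsSymmetric C S U
  | .j5 => IsReal C S U
  | .j7 => IsSymmetric C S U

/-- The parity of `Σ` in column `d`. -/
def Col.parity : Col → Parity
  | .d2 => .even
  | .d4 => .odd
  | .d6 => .odd
  | .d8 => .even

/-- The relation between `Σ` and `F` in column `d`. -/
def Col.Rel (C : ComplexConj H) (Sig F : H →L[ℂ] H) : Col → Prop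
  | .d2 => IsSymmetric C Sig F
  | .d4 => IsReal C Sig F
  | .d6 => IsSymmetric C Sig F
  | .d8 => IsReal C Sig F

/-- `(U, F)` is an index pairing of two unitaries with commuting symmetry operators `S` and `Σ`,
having the symmetries of row `j` and of column `d`. -/
structure IsPairing (C : ComplexConj H) (j : Row) (d : Col) (S Sig U F : H →L[ℂ] H) : Prop where
  unitary_U : U ∈ unitary (H →L[ℂ] H)
  unitary_F : F ∈ unitary (H →L[ℂ] H)
  symm_S : IsSymmetry C j.parity S
  symm_Sig : IsSymmetry C d.parity Sig
  rel_S : j.Rel C S U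
  rel_Sig : d.Rel C Sig F
  comm_S_Sig : Commute S Sig
  comm_S_F : Commute S F
  comm_Sig_P : Commute (diagOp Sig Sig) (doubledProj U)
  fredholm : (pairingOp U F).IsFredholm

/-- The types of `ℤ₂`-indices. -/
inductive IndexType
  | O
  | Q
  | S
  | R

/-- The table: the type of the `ℤ₂`-index for given `(j, d)`, or `none` where the entry is `0`. -/
def entry : Row → Col → Option IndexType
  | .j1, .d8 => some .O
  | .j3, .d2 => some .Q
  | .j5, .d4 => some .S
  | .j7, .d6 => some .R
  | _, _ => none

/-- The symmetry relations that a projection `P`, a unitary `Φ` and symmetry operators `R` and `Θ`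
satisfy for a `ℤ₂`-index of the type O (`P` even Lagrangian), S (`P` odd Lagrangian),
R (`P` even real) or Q (`P` odd real). -/
def IndexType.Rel (C : ComplexConj H) (P Φ R Θ : H →L[ℂ] H) : IndexType → Prop
  | .O => IsSymmetry C .even R ∧ IsLagrangian C R P ∧ IsSymmetry C .even Θ ∧ IsReal C Θ Φ
  | .S => IsSymmetry C .odd R ∧ IsLagrangian C R P ∧ IsSymmetry C .odd Θ ∧ IsReal C Θ Φ
  | .R => IsSymmetry C .even R ∧ IsReal C R P ∧ IsSymmetry C .odd Θ ∧ IsSymmetric C Θ Φ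
  | .Q => IsSymmetry C .odd R ∧ IsReal C R P ∧ IsSymmetry C .even Θ ∧ IsSymmetric C Θ Φ

/-- The pairing `P Φ P + 1 - P` is of type `τ` with respect to `Θ`. -/
def HasType (C : ComplexConj H) (τ : IndexType) (Θ P Φ : H →L[ℂ] H) : Prop :=
  ∃ R : H →L[ℂ] H, τ.Rel C P Φ R Θ ∧ Commute R Θ ∧ Commute R Φ ∧ Commute Θ P

/-- The `ℤ₂`-index is well-defined at `(U, F)`: it is constant along every norm-continuous path of
index pairings starting at `(U, F)` which respects the symmetries and the Fredholm property. -/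
def IsWellDefined (C : ComplexConj H) (j : Row) (d : Col) (S Sig U F : H →L[ℂ] H) : Prop :=
  ∀ γ : C(unitInterval, (H →L[ℂ] H) × (H →L[ℂ] H)), γ 0 = (U, F) →
    (∀ t, IsPairing C j d S Sig (γ t).1 (γ t).2) →
      ∀ t, index₂ (pairingOp (γ t).1 (γ t).2) = index₂ (pairingOp U F)

/-- The `ℤ₂`-index is trivial at `(U, F)`: in an augmented Hilbert space `H ⊕ ℂⁿ`, with the
symmetries augmented by symmetries on `ℂⁿ`, there is a norm-continuous path of index pairings
with the given symmetries from `(U ⊕ u, F ⊕ 1)`, whose pairing operator is that of `(U, F)` plus an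
identity, to a pairing with vanishing `ℤ₂`-index. -/
def IsTrivializable (C : ComplexConj H) (j : Row) (d : Col) (S Sig U F : H →L[ℂ] H) : Prop :=
  ∃ (n : ℕ) (s sig u : EuclideanSpace ℂ (Fin n) →L[ℂ] EuclideanSpace ℂ (Fin n))
    (γ : C(unitInterval, (DSum H (EuclideanSpace ℂ (Fin n)) →L[ℂ]
        DSum H (EuclideanSpace ℂ (Fin n))) ×
      (DSum H (EuclideanSpace ℂ (Fin n)) →L[ℂ] DSum H (EuclideanSpace ℂ (Fin n))))),
    γ 0 = (diagOp U u, diagOp F 1) ∧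
    (∀ t, IsPairing (C.sum (stdConj n)) j d (diagOp S s) (diagOp Sig sig) (γ t).1 (γ t).2) ∧
    index₂ (pairingOp (γ 1).1 (γ 1).2) = 0

end Operators

end FUPairing

end

noncomputable section

open scoped InnerProductSpace ComplexConjugate Kronecker
open Module

namespace FUPairing

/-! ### Parity of the rank of skew-symmetric forms -/

section SkewForms

variable {V : Type*} [AddCommGroup V] [Module ℂ V] [FiniteDimensional ℂ V]

/-! The range of `doubledProj U` is the graph `{(U x, x)}`, a copy of `H`. On it the pairing
operator acts as `U^* (F U + U F) / 2`, and on the complement it is the identity. So the kernel, the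
Fredholm property and both indices can be read off the anticommutator `F U + U F`. Since the adjoint
pairing operator is the one of `F^*`, and `F` maps one kernel onto the other, the Noether index
vanishes.

All symmetries are then combined in the antiunitary `J = S Σ C`, whose square is the product of the
two parities. Because `Σ` commutes with `U` and `S` with `F`, each of `U` and `F` is either real (it
commutes with `J`) or symmetric (`A^* J = J A`). The sixteen entries are thus sorted by two kinds
and one sign.

Kramers degeneracy: if `J² = -1` and at least one of `U`, `F` is real, one of `J`, `J F`, `J U`
preserves the kernel and squares to `-1`. If both are symmetric and `J² = 1`, then `J U F` does so
on the kernel. In these cases the dimension is even.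

Stability: if both are symmetric with `J² = -1`, the form `⟪J B x, y⟫` with `B = F U + U F` is skew.
If both are real with `J² = 1`, the unitary `W = (U F)^* F U` commutes with `J` and `⟪J (1 + W) x,
(1 - W) y⟫` is skew, while `ker (1 + W) = ker B`. Near a given point of the path a Lyapunov-Schmidt
reduction restricts this form to a finite-dimensional space of fixed dimension, with radical the
current kernel. A skew form has even rank, so the parity of the kernel is locally constant
(`eventually_finrank_ker_mod_two`).

Four entries remain, with one real and one symmetric unitary and `J² = 1`. There the index may be
odd, but it is not protected. A twelve-dimensional pairing is added whose `F` moves from `1`, with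
trivial pairing operator, to a point with one-dimensional kernel, which makes the total index even.
It is built from a 3-cycle and a diagonal matrix of phases on `ℂ³`, with two further factors `ℂ²`
carrying the symmetries `s` and `σ`. A square root of `s σ` conjugates the plain conjugation into
the one twisted by `s σ`. -/

/-- A complex space with a nondegenerate skew-symmetric form is even-dimensional. -/
theorem even_finrank_of_skew (b : V →ₗ[ℂ] V →ₗ[ℂ] ℂ) (skew : ∀ x y, b x y = -b y x)
    (hb : LinearMap.ker b = ⊥) : Even (finrank ℂ V) := by
  let B := finBasis ℂ V
  let A := LinearMap.toMatrix₂ B B b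
  have hA : A.transpose = -A := by
    ext i j
    simp only [A, Matrix.transpose_apply, Matrix.neg_apply, LinearMap.toMatrix₂_apply]
    exact skew _ _
  have hdet : A.det ≠ 0 :=
    (LinearMap.separatingLeft_iff_det_ne_zero B).mp (LinearMap.separatingLeft_iff_ker_eq_bot.mpr hb)
  -- `det A = det Aᵗ = (-1)ⁿ det A`, so `n` odd would force `det A = 0`.
  have h := A.det_transpose
  rw [hA, Matrix.det_neg, Fintype.card_fin] at h
  by_contra hodd
  rw [Nat.not_even_iff_odd] at hodd
  rw [hodd.neg_one_pow] at h
  apply hdet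
  linear_combination (-1 / 2 : ℂ) * h

/-- The dimension of a space and of the radical of a skew-symmetric form have the same parity. -/
theorem finrank_eq_finrank_ker_of_skew (b : V →ₗ[ℂ] V →ₗ[ℂ] ℂ) (skew : ∀ x y, b x y = -b y x) :
    (finrank ℂ V : ZMod 2) = finrank ℂ (LinearMap.ker b) := by
  -- On a complement of the radical the form is nondegenerate, hence the complement is
  -- even-dimensional.
  obtain ⟨L, hL⟩ := Submodule.exists_isCompl (LinearMap.ker b)
  have hker : LinearMap.ker (b.domRestrict₁₂ L L) = ⊥ := by
    rw [LinearMap.ker_eq_bot']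
    intro x hx
    have hx' : (x : V) ∈ LinearMap.ker b := by
      rw [LinearMap.mem_ker]
      ext y
      obtain ⟨k, hk, l, hl, rfl⟩ := Submodule.mem_sup.mp
        (hL.sup_eq_top ▸ Submodule.mem_top : y ∈ LinearMap.ker b ⊔ L)
      have h1 : b x l = 0 := LinearMap.congr_fun hx ⟨l, hl⟩
      have h2 : b x k = 0 := by rw [skew, LinearMap.mem_ker.mp hk]; simp
      simp [h1, h2]
    exact Subtype.ext (Submodule.disjoint_def.mp hL.disjoint _ hx' x.2)
  have hev := even_finrank_of_skew (b.domRestrict₁₂ L L) (fun x y => skew x y) hker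
  rw [← Submodule.finrank_add_eq_of_isCompl hL]
  push_cast
  rw [hev.natCast_zmod_two, add_zero]

end SkewForms

/-! ### Antiunitary operators, Kramers degeneracy and stability of the kernel parity -/

section Antiunitary

variable {H : Type*} [NormedAddCommGroup H] [InnerProductSpace ℂ H]

/-- Polarization gives the real parts; replacing `x` by `i x` gives the imaginary parts, with the
sign reversed by antilinearity. -/
theorem inner_map_map_antilinear (J : H →ₗᵢ⋆[ℂ] H) (x y : H) : ⟪J x, J y⟫_ℂ = ⟪y, x⟫_ℂ := by
  have key : ∀ x y : H, (⟪J x, J y⟫_ℂ).re = (⟪x, y⟫_ℂ).re := fun x y => by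
    have h1 := norm_add_sq (𝕜 := ℂ) (J x) (J y)
    have h2 := norm_add_sq (𝕜 := ℂ) x y
    rw [← map_add, J.norm_map, J.norm_map, J.norm_map] at h1
    simp only [RCLike.re_to_complex] at h1 h2
    linarith
  apply Complex.ext
  · rw [key, ← inner_conj_symm, Complex.conj_re]
  · have h := key (Complex.I • x) y
    rw [J.map_smulₛₗ, inner_smul_left, inner_smul_left] at h
    simp only [Complex.conj_I, Complex.mul_re] at h
    simp at h
    rw [← inner_conj_symm y x, Complex.conj_im]
    linarith

/-- For `J² = ε` this makes the bilinear form `⟪J x, y⟫` symmetric or skew according to the sign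
`ε`. -/
theorem inner_map_left_antilinear (J : H →ₗᵢ⋆[ℂ] H) {ε : ℂ} {y : H} (hJ : J (J y) = ε • y)
    (x : H) : ε * ⟪J x, y⟫_ℂ = ⟪J y, x⟫_ℂ := by
  rw [← inner_map_map_antilinear J x, hJ, inner_smul_right]

/-- Kramers degeneracy: a space invariant under an antiunitary squaring to `-1` is
even-dimensional. -/
theorem even_finrank_of_antiunitary (J : H →ₗᵢ⋆[ℂ] H) (N : Submodule ℂ H) [FiniteDimensional ℂ N]
    (hN : ∀ x ∈ N, J x ∈ N) (hJ : ∀ x ∈ N, J (J x) = -x) : Even (finrank ℂ N) := by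
  let b : N →ₗ[ℂ] N →ₗ[ℂ] ℂ := LinearMap.mk₂ ℂ (fun x y => ⟪J x, (y : H)⟫_ℂ)
    (fun x y z => by simp) (fun c x y => by simp [J.map_smulₛₗ, mul_comm])
    (fun x y z => by simp) (fun c x y => by simp)
  apply even_finrank_of_skew b
  · intro x y
    change ⟪J x, (y : H)⟫_ℂ = -⟪J y, (x : H)⟫_ℂ
    rw [← inner_map_left_antilinear J (ε := -1) (by simpa using hJ x x.2)]
    ring
  · rw [LinearMap.ker_eq_bot']
    intro x hx
    have h : ⟪J x, J x⟫_ℂ = 0 := LinearMap.congr_fun hx ⟨J x, hN x x.2⟩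
    rw [inner_map_map_antilinear, inner_self_eq_zero] at h
    exact Subtype.ext h

/-- An antiunitary as a real-linear operator. -/
def antilinearToReal (J : H →ₗᵢ⋆[ℂ] H) : H →L[ℝ] H :=
  LinearMap.mkContinuous
    { toFun := J
      map_add' := J.map_add
      map_smul' := fun r x => by
        change J ((r : ℂ) • x) = (r : ℂ) • J x
        rw [J.map_smulₛₗ, Complex.conj_ofReal] } 1 (fun x => by simp)

variable [CompleteSpace H]

open Filter Topology in
/-- Stability of the parity of the kernel of an operator `T` for which the form
`⟪J T x, G y⟫` is skew-symmetric. -/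
theorem eventually_finrank_ker_mod_two {X : Type*} [TopologicalSpace X] {t₀ : X}
    (T G : X → H →L[ℂ] H) (J : H →ₗᵢ⋆[ℂ] H) (hT : ContinuousAt T t₀) (hG : ContinuousAt G t₀)
    (skew : ∀ t x y, ⟪J (T t x), G t y⟫_ℂ = -⟪J (T t y), G t x⟫_ℂ)
    (hfin : FiniteDimensional ℂ (T t₀).ker) (hclosed : IsClosed ((T t₀).range : Set H))
    (hker : ∀ y, T t₀ y = 0 ↔ ∀ x, ⟪J (T t₀ x), y⟫_ℂ = 0)
    {c : ℂ} (hc : c ≠ 0) (hG₀ : ∀ x, T t₀ x = 0 → G t₀ x = c • x)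
    (hG₁ : ∀ x ∈ (T t₀).kerᗮ, G t₀ x ∈ (T t₀).kerᗮ) :
    ∀ᶠ t in 𝓝 t₀, (finrank ℂ (T t).ker : ZMod 2) = finrank ℂ (T t₀).ker := by
  let N := (T t₀).ker
  have hN : ∀ x, x ∈ N ↔ T t₀ x = 0 := fun x => LinearMap.mem_ker
  let p : H →L[ℂ] H := N.starProjection
  have hp_mem : ∀ x, p x ∈ N := fun x => N.starProjection_apply_mem x
  have hp_self : ∀ x ∈ N, p x = x := fun x hx => Submodule.starProjection_eq_self_iff.mpr hx
  have hp_zero : ∀ x, p x = 0 ↔ x ∈ Nᗮ := fun x => Submodule.starProjection_apply_eq_zero_iff _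
  have hp_sub : ∀ x, x - p x ∈ Nᗮ := fun x => N.sub_starProjection_mem_orthogonal x
  have hdisj : ∀ x, x ∈ N → x ∈ Nᗮ → x = 0 := fun x h1 h2 =>
    Submodule.disjoint_def.mp N.orthogonal_disjoint x h1 h2
  -- Lyapunov-Schmidt operator `(1 - p) J T + p G`, with `p` the projection onto the kernel at `t₀`.
  -- The first summand is antilinear and the second linear, so it is only real-linear.
  let Z : X → H →L[ℝ] H := fun t =>
    ((1 - p).restrictScalars ℝ).comp ((antilinearToReal J).comp ((T t).restrictScalars ℝ)) +
      (p.comp (G t)).restrictScalars ℝ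
  have hZ : ∀ t x, Z t x = (J (T t x) - p (J (T t x))) + p (G t x) := fun t x => rfl
  have hZcont : ContinuousAt Z t₀ := by
    have hr : Continuous (fun A : H →L[ℂ] H => A.restrictScalars ℝ) :=
      (ContinuousLinearMap.restrictScalarsL ℂ H H ℝ ℝ).continuous
    refine ContinuousAt.add ?_ ?_
    · exact continuousAt_const.clm_comp (continuousAt_const.clm_comp
        (hr.continuousAt.comp hT))
    · exact hr.continuousAt.comp (continuousAt_const.clm_comp hG)
  -- By `hker` the range of `J T` at `t₀` has orthogonal complement inside `N`; being closed, it
  -- contains `Nᗮ`.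
  have hrange : ∀ y ∈ Nᗮ, ∃ x, J (T t₀ x) = y := by
    let R : Submodule ℂ H := (LinearMap.range (T t₀ : H →ₗ[ℂ] H)).map
      (J.toLinearMap : H →ₛₗ[starRingEnd ℂ] H)
    have hR : IsClosed (R : Set H) := by
      rw [Submodule.map_coe]
      exact J.isometry.isClosedEmbedding.isClosedMap _ hclosed
    have hR' : Rᗮ ≤ N := by
      intro y hy
      rw [hN, hker]
      intro x
      exact (Submodule.mem_orthogonal R y).mp hy _ ⟨T t₀ x, ⟨x, rfl⟩, rfl⟩
    intro y hy
    have hRc : CompleteSpace R := hR.completeSpace_coe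
    have : y ∈ R := by
      rw [← R.orthogonal_orthogonal]
      exact Submodule.orthogonal_le hR' hy
    obtain ⟨_, ⟨x, rfl⟩, hx⟩ := this
    exact ⟨x, hx⟩
  have hperp : ∀ x, J (T t₀ x) ∈ Nᗮ := fun x => by
    rw [Submodule.mem_orthogonal']
    intro y hy
    exact (hker y).mp ((hN y).mp hy) x
  have hpG : ∀ x, p (G t₀ x) = c • p x := fun x => by
    have h1 : G t₀ x = c • p x + G t₀ (x - p x) := by
      rw [← hG₀ (p x) ((hN _).mp (hp_mem x)), ← map_add]
      congr 1
      abel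
    rw [h1, map_add, (hp_zero _).mpr (hG₁ _ (hp_sub x)), add_zero, map_smul, hp_self _ (hp_mem x)]
  have hZ₀ : ∀ x, Z t₀ x = J (T t₀ x) + c • p x := fun x => by
    rw [hZ, (hp_zero _).mpr (hperp x), sub_zero, hpG]
  -- At `t₀` the operator is `J T + c p`: the first term is injective modulo `N` and has range `Nᗮ`,
  -- the second is invertible on `N`.
  have hbij : Function.Bijective (Z t₀) := by
    constructor
    · rw [← ContinuousLinearMap.coe_coe, ← LinearMap.ker_eq_bot, LinearMap.ker_eq_bot']
      intro x hx
      change Z t₀ x = 0 at hx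
      rw [hZ₀] at hx
      have h1 : c • p x = 0 := by
        refine hdisj _ (N.smul_mem _ (hp_mem x)) ?_
        rw [eq_neg_of_add_eq_zero_right hx]
        exact Nᗮ.neg_mem (hperp x)
      rw [h1, add_zero] at hx
      have h2 : T t₀ x = 0 := J.injective (by rw [hx, map_zero])
      rw [hp_self x ((hN x).mpr h2)] at h1
      exact (smul_eq_zero.mp h1).resolve_left hc
    · intro y
      obtain ⟨x, hx⟩ := hrange _ (hp_sub y)
      refine ⟨x - p x + c⁻¹ • p y, ?_⟩
      have h1 : T t₀ (x - p x + c⁻¹ • p y) = T t₀ x := by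
        rw [map_add, map_sub, map_smul, (hN _).mp (hp_mem x), (hN _).mp (hp_mem y)]
        simp
      rw [hZ₀, h1, hx, map_add, (hp_zero _).mpr (hp_sub x), map_smul, hp_self _ (hp_mem y),
        zero_add, smul_smul, mul_inv_cancel₀ hc, one_smul, sub_add_cancel]
  have hunit : ∀ᶠ t in 𝓝 t₀, IsUnit (Z t) :=
    hZcont.eventually (Units.isOpen.mem_nhds (ContinuousLinearMap.isUnit_iff_bijective.mpr hbij))
  filter_upwards [hunit] with t ht
  have hbt := ContinuousLinearMap.isUnit_iff_bijective.mp ht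
  -- On `M` the component `(1 - p) J T` vanishes, so the invertible `Z t` restricts there to `p G`,
  -- a complex-linear isomorphism onto `N`. Thus `M` has the dimension of `N` and contains the
  -- kernel of `T t`.
  let M : Submodule ℂ H := N.comap
    ((J.toLinearMap : H →ₛₗ[starRingEnd ℂ] H).comp (T t : H →ₗ[ℂ] H))
  have hM : ∀ x, x ∈ M ↔ J (T t x) ∈ N := fun x => Iff.rfl
  let e : M →ₗ[ℂ] N :=
    ((p.comp (G t)).toLinearMap.codRestrict N (fun x => hp_mem _)).comp M.subtype
  have he : ∀ x : M, ((e x : N) : H) = Z t x := fun x => by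
    rw [hZ, hp_self _ ((hM _).mp x.2), sub_self, zero_add]
    rfl
  have hebij : Function.Bijective e := by
    constructor
    · intro x y hxy
      exact Subtype.ext (hbt.1 (by rw [← he, ← he, hxy]))
    · intro y
      obtain ⟨x, hx⟩ := hbt.2 y
      have h1 : J (T t x) - p (J (T t x)) = 0 := by
        refine hdisj _ ?_ (hp_sub _)
        rw [eq_sub_of_add_eq ((hZ t x).symm.trans hx)]
        exact N.sub_mem y.2 (hp_mem _)
      have h2 : x ∈ M := by
        rw [hM, sub_eq_zero.mp h1]
        exact hp_mem _
      exact ⟨⟨x, h2⟩, Subtype.ext ((he ⟨x, h2⟩).trans hx)⟩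
  let eq := LinearEquiv.ofBijective e hebij
  have hMfin : FiniteDimensional ℂ M := eq.symm.finiteDimensional
  have hle : (T t).ker ≤ M := fun x hx => by
    rw [hM, show T t x = 0 from hx, map_zero]
    exact N.zero_mem
  let b : M →ₗ[ℂ] M →ₗ[ℂ] ℂ := LinearMap.mk₂ ℂ (fun x y => ⟪J (T t x), G t y⟫_ℂ)
    (fun x y z => by simp) (fun c x y => by simp [J.map_smulₛₗ, mul_comm])
    (fun x y z => by simp) (fun c x y => by simp)
  have hb : LinearMap.ker b = (T t).ker.comap M.subtype := by
    ext x
    rw [LinearMap.mem_ker, Submodule.mem_comap, LinearMap.mem_ker]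
    constructor
    · intro hx
      -- Testing the form against the `y` in `M` with `p G y = J T x` gives `‖J T x‖² = 0`.
      obtain ⟨y, hy⟩ := hebij.2 ⟨J (T t x), (hM _).mp x.2⟩
      have h1 : ⟪J (T t x), G t y⟫_ℂ = 0 := LinearMap.congr_fun hx y
      have h2 : p (G t y) = J (T t x) := congrArg Subtype.val hy
      have h3 : ⟪J (T t x), J (T t x)⟫_ℂ = 0 := by
        rw [← hp_self _ ((hM x).mp x.2), N.inner_starProjection_left_eq_right] at h1
        rw [← h1]
        exact congrArg _ h2.symm
      rw [inner_self_eq_zero] at h3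
      exact J.injective (by rw [map_zero]; exact h3)
    · intro hx
      ext y
      change ⟪J (T t x), G t y⟫_ℂ = 0
      rw [show T t x = 0 from hx, map_zero, inner_zero_left]
  rw [← eq.finrank_eq, finrank_eq_finrank_ker_of_skew b (fun x y => skew t x y), hb,
    (Submodule.comapSubtypeEquivOfLe hle).finrank_eq]

end Antiunitary

theorem toLp_pair_ext {H K : Type*} {x x' : H} {y y' : K} (hx : x = x') (hy : y = y') :
    (WithLp.toLp 2 (x, y) : DSum H K) = WithLp.toLp 2 (x', y') := by rw [hx, hy]

theorem toLp_pair_inj {H K : Type*} {x x' : H} {y y' : K}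
    (h : (WithLp.toLp 2 (x, y) : DSum H K) = WithLp.toLp 2 (x', y')) : x = x' ∧ y = y' :=
  Prod.ext_iff.mp (congrArg WithLp.ofLp h)

/-! ### Calculus of block operators -/

section Blocks

variable {H K : Type*} [NormedAddCommGroup H] [InnerProductSpace ℂ H]
  [NormedAddCommGroup K] [InnerProductSpace ℂ K]

theorem blockOp_ext {A B : DSum H K →L[ℂ] DSum H K}
    (h : ∀ x y, A (WithLp.toLp 2 (x, y)) = B (WithLp.toLp 2 (x, y))) : A = B :=
  ContinuousLinearMap.ext fun v => h v.fst v.snd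

theorem diagOp_apply (a : H →L[ℂ] H) (d : K →L[ℂ] K) (x : H) (y : K) :
    diagOp a d (WithLp.toLp 2 (x, y)) = WithLp.toLp 2 (a x, d y) := by
  simp [diagOp, blockOp_apply]

theorem blockOp_mul (a a' : H →L[ℂ] H) (b b' : K →L[ℂ] H) (c c' : H →L[ℂ] K)
    (d d' : K →L[ℂ] K) :
    blockOp a b c d * blockOp a' b' c' d' =
      blockOp (a ∘L a' + b ∘L c') (a ∘L b' + b ∘L d') (c ∘L a' + d ∘L c') (c ∘L b' + d ∘L d') := by
  refine blockOp_ext fun x y => ?_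
  simp only [mul_apply_eq_comp, blockOp_apply, map_add, _root_.add_apply,
    ContinuousLinearMap.comp_apply]
  exact toLp_pair_ext (by abel) (by abel)

theorem diagOp_mul (a a' : H →L[ℂ] H) (d d' : K →L[ℂ] K) :
    diagOp a d * diagOp a' d' = diagOp (a * a') (d * d') :=
  blockOp_ext fun x y => by simp only [mul_apply_eq_comp, diagOp_apply]

theorem diagOp_add (a a' : H →L[ℂ] H) (d d' : K →L[ℂ] K) :
    diagOp a d + diagOp a' d' = diagOp (a + a') (d + d') :=
  blockOp_ext fun x y => by
    simp only [_root_.add_apply, diagOp_apply, ← WithLp.toLp_add, Prod.mk_add_mk]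

theorem diagOp_one : diagOp (1 : H →L[ℂ] H) (1 : K →L[ℂ] K) = 1 :=
  blockOp_ext fun x y => by simp only [diagOp_apply, one_apply_eq_self]

theorem diagOp_neg_one : diagOp (-1 : H →L[ℂ] H) (-1 : K →L[ℂ] K) = -1 :=
  blockOp_ext fun x y => by
    simp only [diagOp_apply, _root_.neg_apply, one_apply_eq_self,
      ← WithLp.toLp_neg, Prod.neg_mk]

theorem diagOp_square (p : Parity) :
    diagOp (p.square : H →L[ℂ] H) (p.square : K →L[ℂ] K) = p.square := by
  cases p
  · exact diagOp_one
  · exact diagOp_neg_one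

theorem sum_apply (C : ComplexConj H) (D : ComplexConj K) (x : H) (y : K) :
    (C.sum D).toMap (WithLp.toLp 2 (x, y)) = WithLp.toLp 2 (C.toMap x, D.toMap y) := rfl

theorem bar_diagOp (C : ComplexConj H) (D : ComplexConj K) (a : H →L[ℂ] H) (d : K →L[ℂ] K) :
    (C.sum D).bar (diagOp a d) = diagOp (C.bar a) (D.bar d) :=
  blockOp_ext fun x y => by
    simp only [ComplexConj.bar_apply, sum_apply, diagOp_apply]

theorem continuous_diagOp :
    Continuous fun p : (H →L[ℂ] H) × (K →L[ℂ] K) => diagOp p.1 p.2 := by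
  have h : (fun p : (H →L[ℂ] H) × (K →L[ℂ] K) => diagOp p.1 p.2) = fun p =>
      ((WithLp.prodContinuousLinearEquiv 2 ℂ H K).symm : H × K →L[ℂ] DSum H K) ∘L
        (ContinuousLinearMap.inl ℂ H K ∘L p.1 ∘L WithLp.fstL 2 ℂ H K +
          ContinuousLinearMap.inr ℂ H K ∘L p.2 ∘L WithLp.sndL 2 ℂ H K) := by
    funext p
    refine blockOp_ext fun x y => ?_
    rw [diagOp_apply]
    change _ = WithLp.toLp 2 ((p.1 x, (0 : K)) + ((0 : H), p.2 y))
    rw [Prod.mk_add_mk, add_zero, zero_add]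
  rw [h]
  fun_prop

variable [CompleteSpace H] [CompleteSpace K]

theorem star_blockOp (a : H →L[ℂ] H) (b : H →L[ℂ] H) (c : H →L[ℂ] H) (d : H →L[ℂ] H) :
    star (blockOp a b c d) = blockOp (star a) (star c) (star b) (star d) := by
  rw [ContinuousLinearMap.star_eq_adjoint]
  refine ((ContinuousLinearMap.eq_adjoint_iff _ _).mpr fun v w => ?_).symm
  obtain ⟨v₁, v₂⟩ := v
  obtain ⟨w₁, w₂⟩ := w
  simp only [blockOp_apply, WithLp.prod_inner_apply, inner_add_left, inner_add_right,
    ContinuousLinearMap.star_eq_adjoint, ContinuousLinearMap.adjoint_inner_left]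
  ring

theorem star_diagOp (a : H →L[ℂ] H) (d : K →L[ℂ] K) :
    star (diagOp a d) = diagOp (star a) (star d) := by
  rw [ContinuousLinearMap.star_eq_adjoint]
  refine ((ContinuousLinearMap.eq_adjoint_iff _ _).mpr fun v w => ?_).symm
  obtain ⟨v₁, v₂⟩ := v
  obtain ⟨w₁, w₂⟩ := w
  simp only [diagOp_apply, WithLp.prod_inner_apply,
    ContinuousLinearMap.star_eq_adjoint, ContinuousLinearMap.adjoint_inner_left]

theorem diagOp_mem_unitary {a : H →L[ℂ] H} {d : K →L[ℂ] K} (ha : a ∈ unitary (H →L[ℂ] H))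
    (hd : d ∈ unitary (K →L[ℂ] K)) : diagOp a d ∈ unitary (DSum H K →L[ℂ] DSum H K) := by
  rw [Unitary.mem_iff] at *
  rw [star_diagOp, diagOp_mul, diagOp_mul, ha.1, ha.2, hd.1, hd.2, diagOp_one]
  exact ⟨rfl, rfl⟩

end Blocks

/-! ### Fredholm operators and direct sums -/

section Fredholm

variable {H K : Type*} [NormedAddCommGroup H] [InnerProductSpace ℂ H]
  [NormedAddCommGroup K] [InnerProductSpace ℂ K]

open scoped LinearMap.FiniteRangeSetoid in
-- Invertibility modulo finite rank is the form that can be transported explicitly between operators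
-- on different spaces.
theorem isFredholm_iff_exists_mul_sub_one (T : H →L[ℂ] H) :
    T.IsFredholm ↔ ∃ X : H →L[ℂ] H, ((X * T - 1 : H →L[ℂ] H) : H →ₗ[ℂ] H).HasFiniteRange ∧
      ((T * X - 1 : H →L[ℂ] H) : H →ₗ[ℂ] H).HasFiniteRange := by
  rw [ContinuousLinearMap.isFredholm_iff_exists_isQuasiInverse]
  refine exists_congr fun X => and_congr ?_ ?_
  · exact LinearMap.FiniteRangeSetoid.equiv_iff_hasFiniteRange
  · exact LinearMap.FiniteRangeSetoid.equiv_iff_hasFiniteRange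

theorem hasFiniteRange_comp {A : K →L[ℂ] K} (hA : (A : K →ₗ[ℂ] K).HasFiniteRange)
    (f : H →L[ℂ] K) (g : K →L[ℂ] H) : ((g ∘L A ∘L f : H →L[ℂ] H) : H →ₗ[ℂ] H).HasFiniteRange :=
  (hA.comp_right _).comp_left _

theorem isFredholm_diagOp [FiniteDimensional ℂ K] {A : H →L[ℂ] H} (hA : A.IsFredholm)
    (D : K →L[ℂ] K) : (diagOp A D).IsFredholm := by
  rw [isFredholm_iff_exists_mul_sub_one] at hA ⊢
  obtain ⟨X, h1, h2⟩ := hA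
  have key : ∀ Y : H →L[ℂ] H, (Y : H →ₗ[ℂ] H).HasFiniteRange →
      ((diagOp Y (-1 : K →L[ℂ] K) : DSum H K →L[ℂ] DSum H K) :
        DSum H K →ₗ[ℂ] DSum H K).HasFiniteRange := by
    intro Y hY
    have h : diagOp Y (-1 : K →L[ℂ] K) =
        ((WithLp.prodContinuousLinearEquiv 2 ℂ H K).symm : H × K →L[ℂ] DSum H K) ∘L
          ContinuousLinearMap.inl ℂ H K ∘L Y ∘L WithLp.fstL 2 ℂ H K +
        ((WithLp.prodContinuousLinearEquiv 2 ℂ H K).symm : H × K →L[ℂ] DSum H K) ∘L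
          ContinuousLinearMap.inr ℂ H K ∘L (-1 : K →L[ℂ] K) ∘L WithLp.sndL 2 ℂ H K := by
      refine blockOp_ext fun x y => ?_
      rw [diagOp_apply]
      change _ = WithLp.toLp 2 (Y x, (0 : K)) + WithLp.toLp 2 ((0 : H), (-1 : K →L[ℂ] K) y)
      rw [← WithLp.toLp_add, Prod.mk_add_mk, add_zero, zero_add]
    rw [h]
    refine LinearMap.HasFiniteRange.add ?_ ?_
    · exact ((hY.comp_right _).comp_left _).comp_left _
    · exact ((LinearMap.HasFiniteRange.of_isNoetherian_rng.comp_right _).comp_left _).comp_left _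
  have hsub : ∀ Z : H →L[ℂ] H, diagOp Z (0 : K →L[ℂ] K) - 1 = diagOp (Z - 1) (-1) := fun Z => by
    rw [sub_eq_iff_eq_add, ← diagOp_one, diagOp_add, sub_add_cancel, neg_add_cancel]
  -- The zero block is a good enough parametrix: its defect `-1` on `K` has finite rank.
  refine ⟨diagOp X 0, ?_, ?_⟩
  · rw [diagOp_mul, zero_mul, hsub]
    exact key _ h1
  · rw [diagOp_mul, mul_zero, hsub]
    exact key _ h2

theorem finrank_ker_diagOp (A : H →L[ℂ] H) (D : K →L[ℂ] K)
    [FiniteDimensional ℂ A.ker] [FiniteDimensional ℂ D.ker] :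
    finrank ℂ (diagOp A D).ker = finrank ℂ A.ker + finrank ℂ D.ker := by
  rw [← finrank_prod]
  refine LinearEquiv.finrank_eq ?_
  refine LinearEquiv.ofLinearMap
    (((WithLp.fstL 2 ℂ H K).toLinearMap.comp (diagOp A D).ker.subtype).codRestrict A.ker ?_ |>.prod
      (((WithLp.sndL 2 ℂ H K).toLinearMap.comp (diagOp A D).ker.subtype).codRestrict D.ker ?_))
    ((((WithLp.prodContinuousLinearEquiv 2 ℂ H K).symm : H × K →L[ℂ] DSum H K).toLinearMap.comp
      (A.ker.subtype.prodMap D.ker.subtype)).codRestrict (diagOp A D).ker ?_) ?_ ?_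
  · rintro ⟨v, hv⟩
    have h : diagOp A D (WithLp.toLp 2 (v.fst, v.snd)) = WithLp.toLp 2 (0, 0) := hv
    rw [diagOp_apply] at h
    exact (toLp_pair_inj h).1
  · rintro ⟨v, hv⟩
    have h : diagOp A D (WithLp.toLp 2 (v.fst, v.snd)) = WithLp.toLp 2 (0, 0) := hv
    rw [diagOp_apply] at h
    exact (toLp_pair_inj h).2
  · rintro ⟨⟨x, hx⟩, ⟨y, hy⟩⟩
    change diagOp A D (WithLp.toLp 2 (x, y)) = WithLp.toLp 2 (0, 0)
    rw [diagOp_apply]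
    exact toLp_pair_ext hx hy
  · ext v <;> simp
  · exact LinearMap.ext fun v => rfl

end Fredholm

/-! ### Reduction of the pairing operator to the anticommutator -/

section Pairing

variable {H : Type*} [NormedAddCommGroup H] [InnerProductSpace ℂ H] [CompleteSpace H]

theorem star_mul_apply {U : H →L[ℂ] H} (hU : U ∈ unitary (H →L[ℂ] H)) (x : H) :
    star U (U x) = x := by
  rw [← mul_apply_eq_comp, Unitary.star_mul_self_of_mem hU,
    one_apply_eq_self]

theorem mul_star_apply {U : H →L[ℂ] H} (hU : U ∈ unitary (H →L[ℂ] H)) (x : H) :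
    U (star U x) = x := by
  rw [← mul_apply_eq_comp, Unitary.mul_star_self_of_mem hU,
    one_apply_eq_self]

theorem star_compressed (P Φ : H →L[ℂ] H) :
    star (compressed P Φ) = compressed (star P) (star Φ) := by
  rw [compressed, star_sub, star_add, star_mul, star_mul, star_one, compressed, mul_assoc]

/-- The anticommutator `F U + U F`. -/
def anticomm (U F : H →L[ℂ] H) : H →L[ℂ] H := F * U + U * F

omit [CompleteSpace H] in
theorem mem_ker_anticomm {U F : H →L[ℂ] H} {x : H} :
    x ∈ (anticomm U F).ker ↔ F (U x) = -U (F x) := by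
  rw [LinearMap.mem_ker, eq_neg_iff_add_eq_zero]
  rfl

/-- The embedding `x ↦ (U x, x)` onto the range of `doubledProj U`. -/
def graphInj (U : H →L[ℂ] H) : H →L[ℂ] DSum H H :=
  ((WithLp.prodContinuousLinearEquiv 2 ℂ H H).symm : H × H →L[ℂ] DSum H H) ∘L (U.prod 1)

/-- The left inverse `(a, b) ↦ (U^* a + b) / 2` of `graphInj U`. -/
def graphProj (U : H →L[ℂ] H) : DSum H H →L[ℂ] H :=
  (1 / 2 : ℂ) • (star U ∘L WithLp.fstL 2 ℂ H H + WithLp.sndL 2 ℂ H H)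

omit [CompleteSpace H] in
theorem graphInj_apply (U : H →L[ℂ] H) (x : H) : graphInj U x = WithLp.toLp 2 (U x, x) := rfl

theorem graphProj_apply (U : H →L[ℂ] H) (x y : H) :
    graphProj U (WithLp.toLp 2 (x, y)) = (1 / 2 : ℂ) • (star U x + y) := rfl

theorem doubledProj_apply (U : H →L[ℂ] H) (x y : H) : doubledProj U (WithLp.toLp 2 (x, y)) =
    WithLp.toLp 2 ((1 / 2 : ℂ) • (x + U y), (1 / 2 : ℂ) • (star U x + y)) := rfl

variable {U : H →L[ℂ] H} (hU : U ∈ unitary (H →L[ℂ] H))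

include hU

theorem graphProj_graphInj (x : H) : graphProj U (graphInj U x) = x := by
  rw [graphInj_apply, graphProj_apply, star_mul_apply hU, ← two_smul ℂ x, smul_smul]
  norm_num

theorem graphInj_graphProj (v : DSum H H) : graphInj U (graphProj U v) = doubledProj U v := by
  change graphInj U (graphProj U (WithLp.toLp 2 (v.fst, v.snd))) =
    doubledProj U (WithLp.toLp 2 (v.fst, v.snd))
  rw [graphProj_apply, graphInj_apply, doubledProj_apply, map_smul, map_add, mul_star_apply hU]

/-- In the coordinate `x` of the graph, compressing `F ⊕ F` averages `U^* F U` and `F`, which is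
`U^* (F U + U F) / 2`. -/
theorem pairingOp_apply (F : H →L[ℂ] H) (v : DSum H H) : pairingOp U F v =
    graphInj U ((1 / 2 : ℂ) • star U (anticomm U F (graphProj U v))) +
      (v - graphInj U (graphProj U v)) := by
  have h : pairingOp U F v =
      doubledProj U (diagOp F F (doubledProj U v)) + (v - doubledProj U v) := add_sub_assoc _ _ _
  rw [h, ← graphInj_graphProj hU, ← graphInj_graphProj hU, graphInj_apply U (graphProj U v),
    diagOp_apply, graphProj_apply]
  congr 3
  change _ = star U (F (U _) + U (F _))
  rw [map_add, star_mul_apply hU]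

omit hU in
theorem star_doubledProj : star (doubledProj U) = doubledProj U := by
  rw [doubledProj, star_smul, star_blockOp]
  simp

omit hU in
theorem star_pairingOp (F : H →L[ℂ] H) : star (pairingOp U F) = pairingOp U (star F) := by
  rw [pairingOp, star_compressed, star_doubledProj, star_diagOp, pairingOp]

theorem ker_pairingOp (F : H →L[ℂ] H) :
    (pairingOp U F).ker = (anticomm U F).ker.map (graphInj U : H →ₗ[ℂ] DSum H H) := by
  ext v
  rw [Submodule.mem_map]
  constructor
  · intro hv
    have hv' : pairingOp U F v = 0 := hv
    rw [pairingOp_apply hU] at hv'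
    have h1 := congrArg (graphProj U) hv'
    rw [map_add, map_sub, graphProj_graphInj hU, graphProj_graphInj hU, sub_self, add_zero,
      map_zero] at h1
    refine ⟨graphProj U v, ?_, ?_⟩
    · have h2 := (smul_eq_zero.mp h1).resolve_left (by norm_num)
      have h3 := congrArg U h2
      rwa [mul_star_apply hU, map_zero] at h3
    · rw [h1, map_zero, zero_add, sub_eq_zero] at hv'
      exact hv'.symm
  · rintro ⟨x, hx, rfl⟩
    change pairingOp U F (graphInj U x) = 0
    rw [pairingOp_apply hU, graphProj_graphInj hU, show anticomm U F x = 0 from hx]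
    simp

theorem finrank_ker_pairingOp (F : H →L[ℂ] H) :
    finrank ℂ (pairingOp U F).ker = finrank ℂ (anticomm U F).ker := by
  rw [ker_pairingOp hU]
  refine (Submodule.equivMapOfInjective _ ?_ _).finrank_eq.symm
  exact Function.LeftInverse.injective (graphProj_graphInj hU)

theorem index₂_pairingOp (F : H →L[ℂ] H) :
    index₂ (pairingOp U F) = (finrank ℂ (anticomm U F).ker : ZMod 2) := by
  rw [index₂, finrank_ker_pairingOp hU]

/-- Parametrices correspond: compress to the graph in one direction, extend by the identity off the
graph in the other, and absorb the unitary factor `U^* / 2` or its inverse `2 U`. The defects stay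
of finite rank. -/
theorem isFredholm_pairingOp_iff (F : H →L[ℂ] H) :
    (pairingOp U F).IsFredholm ↔ (anticomm U F).IsFredholm := by
  rw [isFredholm_iff_exists_mul_sub_one, isFredholm_iff_exists_mul_sub_one]
  constructor
  · rintro ⟨X, h1, h2⟩
    refine ⟨graphProj U ∘L X ∘L graphInj U ∘L ((1 / 2 : ℂ) • star U), ?_, ?_⟩
    · convert hasFiniteRange_comp h1 (graphInj U) (graphProj U) using 2
      ext x
      simp [pairingOp_apply hU, graphProj_graphInj hU]
    · convert hasFiniteRange_comp h2 (graphInj U ∘L ((1 / 2 : ℂ) • star U))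
        (((2 : ℂ) • U) ∘L graphProj U) using 2
      ext x
      simp [pairingOp_apply hU, graphProj_graphInj hU, mul_star_apply hU, smul_sub, smul_smul]
  · rintro ⟨X, h1, h2⟩
    refine ⟨graphInj U ∘L X ∘L ((2 : ℂ) • U) ∘L graphProj U + (1 - graphInj U ∘L graphProj U),
      ?_, ?_⟩
    · convert hasFiniteRange_comp h1 (graphProj U) (graphInj U) using 2
      ext1 x
      simp [pairingOp_apply hU, graphProj_graphInj hU, mul_star_apply hU]
      abel
    · convert hasFiniteRange_comp h2 (((2 : ℂ) • U) ∘L graphProj U)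
        (graphInj U ∘L ((1 / 2 : ℂ) • star U)) using 2
      ext1 x
      simp [pairingOp_apply hU, graphProj_graphInj hU, star_mul_apply hU, smul_sub, smul_smul]
      abel

/-- The adjoint is the pairing operator of `F^*`, and `F` carries the kernel of `F U + U F`
bijectively onto that of `F^* U + U F^*`. -/
theorem noetherIndex_pairingOp {F : H →L[ℂ] H} (hF : F ∈ unitary (H →L[ℂ] H)) :
    noetherIndex (pairingOp U F) = 0 := by
  have hker : (anticomm U (star F)).ker = (anticomm U F).ker.map (F : H →ₗ[ℂ] H) := by
    ext y
    rw [Submodule.mem_map, mem_ker_anticomm]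
    constructor
    · intro hy
      refine ⟨star F y, ?_, mul_star_apply hF y⟩
      rw [mem_ker_anticomm, mul_star_apply hF, eq_neg_iff_add_eq_zero,
        ← neg_eq_iff_add_eq_zero, ← map_neg, ← hy, mul_star_apply hF]
    · rintro ⟨x, hx, rfl⟩
      rw [mem_ker_anticomm] at hx
      change star F (U (F x)) = -U (star F (F x))
      rw [star_mul_apply hF, ← neg_eq_iff_eq_neg, ← map_neg, ← hx, star_mul_apply hF]
  rw [noetherIndex, star_pairingOp, finrank_ker_pairingOp hU, finrank_ker_pairingOp hU, hker,
    ← (Submodule.equivMapOfInjective (F : H →ₗ[ℂ] H)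
      (Function.LeftInverse.injective (star_mul_apply hF)) _).finrank_eq, sub_self]

end Pairing

/-- The sign `1` (even) or `-1` (odd) of a parity. -/
def Parity.sign : Parity → ℂ
  | .even => 1
  | .odd => -1

/-! ### Symmetry relations as relations with antiunitary operators -/

section Conjugation

variable {H : Type*} [NormedAddCommGroup H] [InnerProductSpace ℂ H]

theorem Parity.square_apply (p : Parity) (v : H) : (p.square : H →L[ℂ] H) v = p.sign • v := by
  cases p <;> simp [Parity.square, Parity.sign]

theorem Parity.square_eq (p : Parity) : (p.square : H →L[ℂ] H) = p.sign • 1 := by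
  cases p <;> simp [Parity.square, Parity.sign]

theorem bar_mul (C : ComplexConj H) (A B : H →L[ℂ] H) : C.bar (A * B) = C.bar A * C.bar B := by
  ext v
  simp only [mul_apply_eq_comp, ComplexConj.bar_apply, C.involutive]

theorem bar_one (C : ComplexConj H) : C.bar 1 = 1 := by
  ext v
  simp only [one_apply_eq_self, ComplexConj.bar_apply, C.involutive]

theorem bar_add (C : ComplexConj H) (A B : H →L[ℂ] H) : C.bar (A + B) = C.bar A + C.bar B := by
  ext v
  simp only [_root_.add_apply, ComplexConj.bar_apply, map_add]

theorem bar_smul (C : ComplexConj H) (c : ℂ) (A : H →L[ℂ] H) :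
    C.bar (c • A) = (starRingEnd ℂ c) • C.bar A := by
  ext v
  simp only [_root_.smul_apply, ComplexConj.bar_apply, C.toMap.map_smulₛₗ]

theorem inner_conj_left (C : ComplexConj H) (x y : H) :
    ⟪C.toMap x, y⟫_ℂ = ⟪C.toMap y, x⟫_ℂ := by
  rw [← inner_map_left_antilinear C.toMap (ε := 1) (by rw [C.involutive, one_smul]), one_mul]

variable [CompleteSpace H]

theorem star_bar (C : ComplexConj H) (A : H →L[ℂ] H) : star (C.bar A) = C.bar (star A) := by
  rw [ContinuousLinearMap.star_eq_adjoint]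
  refine ((ContinuousLinearMap.eq_adjoint_iff _ _).mpr fun v w => ?_).symm
  rw [ComplexConj.bar_apply, inner_conj_left, ContinuousLinearMap.star_eq_adjoint,
    ContinuousLinearMap.adjoint_inner_right, ← inner_conj_symm, inner_conj_left,
    inner_conj_symm, ComplexConj.bar_apply, ← inner_conj_symm, inner_conj_left, inner_conj_symm]

theorem IsSymmetry.conj_apply {C : ComplexConj H} {p : Parity} {S : H →L[ℂ] H}
    (hS : IsSymmetry C p S) (v : H) : C.toMap (S v) = S (C.toMap v) := by
  conv_rhs => rw [← hS.real, ComplexConj.bar_apply, C.involutive]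

theorem IsSymmetry.apply_apply {C : ComplexConj H} {p : Parity} {S : H →L[ℂ] H}
    (hS : IsSymmetry C p S) (v : H) : S (S v) = p.sign • v := by
  rw [← mul_apply_eq_comp, hS.square, p.square_apply]

theorem star_mul_mul_eq_iff {S A B : H →L[ℂ] H} (hS : S ∈ unitary (H →L[ℂ] H)) :
    star S * B * S = A ↔ B * S = S * A := by
  constructor
  · rintro rfl
    rw [← mul_assoc, ← mul_assoc, Unitary.mul_star_self_of_mem hS, one_mul]
  · intro h
    rw [mul_assoc, h, ← mul_assoc, Unitary.star_mul_self_of_mem hS, one_mul]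

theorem isReal_iff {C : ComplexConj H} {p : Parity} {S : H →L[ℂ] H} (hS : IsSymmetry C p S)
    (A : H →L[ℂ] H) : IsReal C S A ↔ ∀ v, A (S (C.toMap v)) = S (C.toMap (A v)) := by
  rw [IsReal, star_mul_mul_eq_iff hS.unitary]
  constructor
  · intro h v
    have := congrArg (fun B : H →L[ℂ] H => C.toMap (B v)) h
    simp only [mul_apply_eq_comp, ComplexConj.bar_apply, C.involutive, hS.conj_apply] at this
    exact this
  · intro h
    ext v
    rw [mul_apply_eq_comp, mul_apply_eq_comp, ComplexConj.bar_apply, hS.conj_apply, h,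
      hS.conj_apply, C.involutive]

theorem isSymmetric_iff {C : ComplexConj H} {p : Parity} {S : H →L[ℂ] H} (hS : IsSymmetry C p S)
    (A : H →L[ℂ] H) :
    IsSymmetric C S A ↔ ∀ v, star A (S (C.toMap v)) = S (C.toMap (A v)) := by
  rw [IsSymmetric, star_mul_mul_eq_iff hS.unitary, ComplexConj.transpose, star_bar]
  constructor
  · intro h v
    have := congrArg (fun B : H →L[ℂ] H => C.toMap (B v)) h
    simp only [mul_apply_eq_comp, ComplexConj.bar_apply, C.involutive, hS.conj_apply] at this
    exact this
  · intro h
    ext v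
    rw [mul_apply_eq_comp, mul_apply_eq_comp, ComplexConj.bar_apply, hS.conj_apply, h,
      hS.conj_apply, C.involutive]

theorem commute_star_of_mem_unitary {S A : H →L[ℂ] H} (hA : A ∈ unitary (H →L[ℂ] H))
    (h : Commute S A) : Commute S (star A) := by
  have h1 : star A * (S * A) * star A = star A * (A * S) * star A := by rw [h.eq]
  rw [mul_assoc, mul_assoc, Unitary.mul_star_self_of_mem hA, mul_one, ← mul_assoc,
    Unitary.star_mul_self_of_mem hA, one_mul] at h1
  exact h1.symm

/-- Only the off-diagonal entries `U` and `U^*` matter, and for unitary `U` commuting with `U`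
implies commuting with `U^*`. -/
theorem commute_diagOp_doubledProj_iff {Sig U : H →L[ℂ] H} (hU : U ∈ unitary (H →L[ℂ] H)) :
    Commute (diagOp Sig Sig) (doubledProj U) ↔ Commute Sig U := by
  constructor
  · intro h
    ext y
    have h1 := congrArg (fun A : DSum H H →L[ℂ] DSum H H => A (WithLp.toLp 2 (0, y))) h.eq
    simp only [mul_apply_eq_comp, doubledProj_apply, diagOp_apply] at h1
    have h2 := (toLp_pair_inj h1).1
    simp only [zero_add, map_smul, map_zero] at h2
    exact smul_right_injective H (by norm_num : (1 / 2 : ℂ) ≠ 0) h2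
  · intro h
    have h' := commute_star_of_mem_unitary hU h
    refine blockOp_ext fun x y => ?_
    simp only [mul_apply_eq_comp, doubledProj_apply, diagOp_apply, map_smul, map_add]
    rw [← mul_apply_eq_comp Sig U, h.eq, mul_apply_eq_comp, ← mul_apply_eq_comp Sig (star U), h'.eq,
      mul_apply_eq_comp]

/-- The antiunitary operator `v ↦ S (C v)`. -/
def antiunitary (C : ComplexConj H) {S : H →L[ℂ] H} (hS : S ∈ unitary (H →L[ℂ] H)) :
    H →ₗᵢ⋆[ℂ] H where
  toLinearMap := (S : H →ₗ[ℂ] H).comp C.toMap.toLinearMap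
  norm_map' _ := (ContinuousLinearMap.norm_map_of_mem_unitary hS _).trans (C.toMap.norm_map _)

theorem antiunitary_apply (C : ComplexConj H) {S : H →L[ℂ] H} (hS : S ∈ unitary (H →L[ℂ] H))
    (v : H) : antiunitary C hS v = S (C.toMap v) := rfl

/-- The composition of an antiunitary operator with a unitary operator. -/
def antiunitaryComp (J : H →ₗᵢ⋆[ℂ] H) {A : H →L[ℂ] H} (hA : A ∈ unitary (H →L[ℂ] H)) :
    H →ₗᵢ⋆[ℂ] H where
  toLinearMap := J.toLinearMap.comp (A : H →ₗ[ℂ] H)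
  norm_map' _ := (J.norm_map _).trans (ContinuousLinearMap.norm_map_of_mem_unitary hA _)

theorem antiunitaryComp_apply (J : H →ₗᵢ⋆[ℂ] H) {A : H →L[ℂ] H} (hA : A ∈ unitary (H →L[ℂ] H))
    (v : H) : antiunitaryComp J hA v = J (A v) := rfl

end Conjugation

/-! ### Even-dimensional kernels from Kramers degeneracy -/

section Kramers

variable {H : Type*} [NormedAddCommGroup H] [InnerProductSpace ℂ H] [CompleteSpace H]
  {U F : H →L[ℂ] H} (hU : U ∈ unitary (H →L[ℂ] H)) (hF : F ∈ unitary (H →L[ℂ] H))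
  (J : H →ₗᵢ⋆[ℂ] H) [FiniteDimensional ℂ (anticomm U F).ker]

omit [CompleteSpace H] in
theorem even_finrank_ker_of_real_real (hJ : ∀ v, J (J v) = -v) (hJU : ∀ v, U (J v) = J (U v))
    (hJF : ∀ v, F (J v) = J (F v)) : Even (finrank ℂ (anticomm U F).ker) := by
  refine even_finrank_of_antiunitary J _ (fun x hx => ?_) fun x _ => hJ x
  rw [mem_ker_anticomm] at hx ⊢
  rw [hJU, hJF, hx, hJF, hJU, map_neg]

include hF in
-- Kramers degeneracy for `J F`: symmetry of `F` reads `F J F = J`, so `(J F)² = J² = -1`.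
theorem even_finrank_ker_of_real_symmetric (hJ : ∀ v, J (J v) = -v)
    (hJU : ∀ v, U (J v) = J (U v)) (hJF : ∀ v, star F (J v) = J (F v)) :
    Even (finrank ℂ (anticomm U F).ker) := by
  have hJF' : ∀ v, F (J (F v)) = J v := fun v => by rw [← hJF, mul_star_apply hF]
  refine even_finrank_of_antiunitary (antiunitaryComp J hF) _ (fun x hx => ?_) fun x _ => ?_
  · rw [mem_ker_anticomm] at hx ⊢
    rw [antiunitaryComp_apply, hJU, hJF', hJU, ← neg_eq_iff_eq_neg, ← map_neg, ← map_neg, ← hx,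
      hJF']
  · rw [antiunitaryComp_apply, antiunitaryComp_apply, hJF', hJ]

include hU in
-- Kramers degeneracy for `J U`, since `U J U = J`.
theorem even_finrank_ker_of_symmetric_real (hJ : ∀ v, J (J v) = -v)
    (hJU : ∀ v, star U (J v) = J (U v)) (hJF : ∀ v, F (J v) = J (F v)) :
    Even (finrank ℂ (anticomm U F).ker) := by
  have hJU' : ∀ v, U (J (U v)) = J v := fun v => by rw [← hJU, mul_star_apply hU]
  refine even_finrank_of_antiunitary (antiunitaryComp J hU) _ (fun x hx => ?_) fun x _ => ?_
  · rw [mem_ker_anticomm] at hx ⊢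
    rw [antiunitaryComp_apply, hJU', hJF, hJF, hx, map_neg, map_neg, neg_neg, hJU']
  · rw [antiunitaryComp_apply, antiunitaryComp_apply, hJU', hJ]

include hU hF in
-- Kramers degeneracy for `J U F`. On the kernel `U F = -F U`, hence `U F J U F = -J`: the
-- anticommutation supplies the sign, so `J² = 1` is what is needed. The square is `-1` only on the
-- kernel.
theorem even_finrank_ker_of_symmetric_symmetric (hJ : ∀ v, J (J v) = v)
    (hJU : ∀ v, star U (J v) = J (U v)) (hJF : ∀ v, star F (J v) = J (F v)) :
    Even (finrank ℂ (anticomm U F).ker) := by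
  have hJU' : ∀ v, U (J (U v)) = J v := fun v => by rw [← hJU, mul_star_apply hU]
  have hJF' : ∀ v, F (J (F v)) = J v := fun v => by rw [← hJF, mul_star_apply hF]
  have hkey : ∀ x, F (U x) = -U (F x) → F (U (J (U (F x)))) = J x ∧ U (F (J (U (F x)))) = -J x :=
    fun x hx => by
      refine ⟨by rw [hJU', hJF'], ?_⟩
      rw [← neg_eq_iff_eq_neg.mpr hx, map_neg, map_neg, map_neg, hJF', hJU']
  refine even_finrank_of_antiunitary (antiunitaryComp J (mul_mem hU hF)) _ (fun x hx => ?_)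
    fun x hx => ?_
  · rw [mem_ker_anticomm] at hx ⊢
    rw [antiunitaryComp_apply, mul_apply_eq_comp, (hkey x hx).1, (hkey x hx).2, neg_neg]
  · rw [mem_ker_anticomm] at hx
    rw [antiunitaryComp_apply, antiunitaryComp_apply, mul_apply_eq_comp, mul_apply_eq_comp,
      (hkey x hx).2, map_neg, hJ]

end Kramers

/-! ### Local constancy of the parity of the kernel -/

section Stability

variable {H : Type*} [NormedAddCommGroup H] [InnerProductSpace ℂ H] [CompleteSpace H]
  {X : Type*} [TopologicalSpace X] {U F : X → H →L[ℂ] H} (hUc : Continuous U) (hFc : Continuous F)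
  (hU : ∀ t, U t ∈ unitary (H →L[ℂ] H)) (hF : ∀ t, F t ∈ unitary (H →L[ℂ] H))
  (J : H →ₗᵢ⋆[ℂ] H) (hfred : ∀ t, (anticomm (U t) (F t)).IsFredholm)

include hUc hFc hfred in
open Filter Topology in
-- The anticommutator `B` satisfies `J B = B^* J`; together with `J² = -1` this makes `⟪J B x, y⟫`
-- skew.
theorem isLocallyConstant_of_symmetric_symmetric
    (hJ : ∀ v, J (J v) = -v) (hJU : ∀ t v, star (U t) (J v) = J (U t v))
    (hJF : ∀ t v, star (F t) (J v) = J (F t v)) :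
    IsLocallyConstant fun t => (finrank ℂ (anticomm (U t) (F t)).ker : ZMod 2) := by
  rw [IsLocallyConstant.iff_eventually_eq]
  intro t₀
  have hcont : Continuous fun t => anticomm (U t) (F t) := by
    unfold anticomm
    fun_prop
  have hB : ∀ t v, J (anticomm (U t) (F t) v) = star (anticomm (U t) (F t)) (J v) := fun t v => by
    simp only [anticomm, star_add, star_mul, _root_.add_apply, mul_apply_eq_comp, hJF, hJU, map_add]
    exact add_comm _ _
  have skew : ∀ t x y, ⟪J (anticomm (U t) (F t) x), (1 : H →L[ℂ] H) y⟫_ℂ =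
      -⟪J (anticomm (U t) (F t) y), (1 : H →L[ℂ] H) x⟫_ℂ := fun t x y => by
    rw [one_apply_eq_self, one_apply_eq_self, ← inner_map_left_antilinear J (ε := -1)
      (y := anticomm (U t) (F t) y) (by rw [hJ, neg_one_smul]), hB,
      ContinuousLinearMap.star_eq_adjoint, ContinuousLinearMap.adjoint_inner_left]
    ring
  have h0 := hfred t₀
  refine eventually_finrank_ker_mod_two (fun t => anticomm (U t) (F t)) (fun _ => 1) J
    hcont.continuousAt continuousAt_const skew h0.finite_ker h0.isClosed_range (fun y => ?_)
    one_ne_zero (fun x _ => by simp) (fun x hx => hx)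
  have h1 : ∀ x, ⟪J (anticomm (U t₀) (F t₀) x), y⟫_ℂ = -⟪J (anticomm (U t₀) (F t₀) y), x⟫_ℂ :=
    fun x => skew t₀ x y
  simp_rw [h1, neg_eq_zero]
  constructor
  · intro h x
    rw [h, map_zero, inner_zero_left]
  · intro h
    have := h (J (anticomm (U t₀) (F t₀) y))
    rw [inner_self_eq_zero] at this
    exact J.injective (by rw [this, map_zero])

include hUc hFc hU hF hfred in
open Filter Topology in
-- Here `⟪J B x, y⟫` need not be skew. The kernel is the `-1` eigenspace of the unitary `W`, which
-- commutes with `J`, and the Cayley transform of `W` is skew-adjoint. Cleared of its denominator it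
-- yields the skew form `⟪J (1 + W) x, (1 - W) y⟫`.
theorem isLocallyConstant_of_real_real
    (hJ : ∀ v, J (J v) = v) (hJU : ∀ t v, U t (J v) = J (U t v))
    (hJF : ∀ t v, F t (J v) = J (F t v)) :
    IsLocallyConstant fun t => (finrank ℂ (anticomm (U t) (F t)).ker : ZMod 2) := by
  rw [IsLocallyConstant.iff_eventually_eq]
  intro t₀
  let W : X → H →L[ℂ] H := fun t => star (U t * F t) * (F t * U t)
  have hW : ∀ t, W t ∈ unitary (H →L[ℂ] H) := fun t =>
    mul_mem (Unitary.star_mem (mul_mem (hU t) (hF t))) (mul_mem (hF t) (hU t))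
  have hWcont : Continuous W := by
    have h1 : Continuous fun t => star (U t * F t) := (hUc.mul hFc).star
    exact h1.mul (hFc.mul hUc)
  have hstar : ∀ {A : H →L[ℂ] H}, A ∈ unitary (H →L[ℂ] H) → (∀ v, A (J v) = J (A v)) →
      ∀ v, star A (J v) = J (star A v) := fun {A} hA h v => by
    conv_lhs => rw [← mul_star_apply hA v, ← h, star_mul_apply hA]
  have hJW : ∀ t v, W t (J v) = J (W t v) := fun t v => by
    simp only [W, star_mul, mul_apply_eq_comp, hJU, hJF, hstar (hU t) (hJU t),
      hstar (hF t) (hJF t)]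
  have hanti : ∀ t, anticomm (U t) (F t) = (U t * F t) * (1 + W t) := fun t => by
    rw [mul_add, mul_one, ← mul_assoc, Unitary.mul_star_self_of_mem (mul_mem (hU t) (hF t)),
      one_mul, anticomm, add_comm]
  have hone : ∀ t, 1 + W t = star (U t * F t) * anticomm (U t) (F t) := fun t => by
    rw [hanti, ← mul_assoc, Unitary.star_mul_self_of_mem (mul_mem (hU t) (hF t)), one_mul]
  have hker : ∀ t, (1 + W t).ker = (anticomm (U t) (F t)).ker := fun t => by
    ext x
    rw [LinearMap.mem_ker, LinearMap.mem_ker]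
    constructor
    · intro h
      have h' : (1 + W t) x = 0 := h
      change anticomm (U t) (F t) x = 0
      rw [hanti, mul_apply_eq_comp, h', map_zero]
    · intro h
      have h' : anticomm (U t) (F t) x = 0 := h
      change (1 + W t) x = 0
      rw [hone, mul_apply_eq_comp, h', map_zero]
  suffices h : ∀ᶠ t in 𝓝 t₀, (finrank ℂ (1 + W t).ker : ZMod 2) = finrank ℂ (1 + W t₀).ker by
    filter_upwards [h] with t ht
    rwa [hker, hker] at ht
  have hone_apply : ∀ t x, (1 + W t) x = x + W t x := fun t x => rfl
  have hsub_apply : ∀ t x, (1 - W t) x = x - W t x := fun t x => rfl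
  have hswap : ∀ x y, ⟪J x, y⟫_ℂ = ⟪J y, x⟫_ℂ := fun x y => by
    rw [← inner_map_left_antilinear J (ε := 1) (y := y) (by rw [hJ, one_smul]), one_mul]
  have hWinner : ∀ t x y, ⟪W t x, W t y⟫_ℂ = ⟪x, y⟫_ℂ := fun t x y =>
    ContinuousLinearMap.inner_map_map_of_mem_unitary (hW t) x y
  have heig : ∀ t x, (1 + W t) x = 0 ↔ W t x = -x := fun t x => by
    rw [hone_apply, add_comm, eq_neg_iff_add_eq_zero]
  have heig' : ∀ t x, (1 + star (W t)) x = 0 ↔ W t x = -x := fun t x => by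
    rw [_root_.add_apply, one_apply_eq_self, ← eq_neg_iff_add_eq_zero]
    constructor
    · intro h
      conv_lhs => rw [h, map_neg, mul_star_apply (hW t)]
    · intro h
      have h' := star_mul_apply (hW t) x
      rw [h, map_neg] at h'
      exact h'.symm
  have h0 := hfred t₀
  -- The constant is `2` because `1 - W = 2` on the kernel of `1 + W`.
  refine eventually_finrank_ker_mod_two (fun t => 1 + W t) (fun t => 1 - W t) J
    (continuous_const.add hWcont).continuousAt (continuous_const.sub hWcont).continuousAt
    (fun t x y => ?_) (by rw [hker]; exact h0.finite_ker) ?_ (fun y => ?_)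
    (two_ne_zero (α := ℂ)) (fun x hx => ?_) (fun x hx => ?_)
  · simp only [hone_apply, hsub_apply, map_add, ← hJW, inner_add_left, inner_sub_right, hWinner]
    rw [hswap x y, hJW, hJW, hswap (W t x) y, hswap x (W t y)]
    ring
  -- As `B = U F (1 + W)`, the range is a preimage of the closed range of the Fredholm operator `B`.
  · have : ((1 + W t₀).range : Set H) =
        (U t₀ * F t₀) ⁻¹' ((anticomm (U t₀) (F t₀)).range : Set H) := by
      ext y
      constructor
      · rintro ⟨x, rfl⟩
        exact ⟨x, congrArg (fun A : H →L[ℂ] H => A x) (hanti t₀)⟩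
      · rintro ⟨x, hx⟩
        refine ⟨x, ?_⟩
        have hx' : anticomm (U t₀) (F t₀) x = (U t₀ * F t₀) y := hx
        change (1 + W t₀) x = y
        rw [hone, mul_apply_eq_comp, hx', star_mul_apply (mul_mem (hU t₀) (hF t₀))]
    rw [this]
    exact h0.isClosed_range.preimage (U t₀ * F t₀).continuous
  · have h1 : ∀ x, ⟪J ((1 + W t₀) x), y⟫_ℂ = ⟪(1 + star (W t₀)) (J y), x⟫_ℂ := fun x => by
      rw [hswap, _root_.add_apply, _root_.add_apply, inner_add_left, inner_add_right,
        ContinuousLinearMap.star_eq_adjoint, ContinuousLinearMap.adjoint_inner_left]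
      rfl
    simp_rw [h1]
    have h2 : (1 + W t₀) y = 0 ↔ (1 + star (W t₀)) (J y) = 0 := by
      rw [heig, heig', hJW, ← map_neg]
      exact J.injective.eq_iff.symm
    rw [h2]
    exact ⟨fun h x => by rw [h, inner_zero_left], fun h => inner_self_eq_zero.mp (h _)⟩
  · rw [hsub_apply, (heig t₀ x).mp hx, two_smul, sub_neg_eq_add]
  · rw [Submodule.mem_orthogonal] at hx ⊢
    intro n hn
    have hn' := (heig t₀ n).mp hn
    have h3 : ⟪n, W t₀ x⟫_ℂ = -⟪n, x⟫_ℂ := by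
      rw [← hWinner t₀ n x, hn', inner_neg_left, neg_neg]
    change ⟪n, (1 - W t₀) x⟫_ℂ = 0
    rw [hsub_apply, inner_sub_right, h3, hx n hn]
    simp

end Stability

/-! ### Eigenspaces of symmetry operators and of their sums -/

section Eigenspaces

variable {H K : Type*} [NormedAddCommGroup H] [InnerProductSpace ℂ H]
  [NormedAddCommGroup K] [InnerProductSpace ℂ K]

theorem mem_eigenspace_iff {S : H →L[ℂ] H} {μ : ℂ} {x : H} :
    x ∈ End.eigenspace (S : H →ₗ[ℂ] H) μ ↔ S x = μ • x := End.mem_eigenspace_iff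

theorem hasEigenvalue_iff {S : H →L[ℂ] H} {μ : ℂ} :
    End.HasEigenvalue (S : H →ₗ[ℂ] H) μ ↔ ∃ x, S x = μ • x ∧ x ≠ 0 := by
  constructor
  · intro h
    obtain ⟨x, hx⟩ := h.exists_hasEigenvector
    exact ⟨x, mem_eigenspace_iff.mp hx.1, hx.2⟩
  · rintro ⟨x, hx, hx0⟩
    exact End.hasEigenvalue_of_hasEigenvector ⟨mem_eigenspace_iff.mpr hx, hx0⟩

theorem eigenvalue_eq_or_eq_neg {p : Parity} {S : H →L[ℂ] H} (hS : S * S = p.square) {μ ν : ℂ}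
    (hμ : End.HasEigenvalue (S : H →ₗ[ℂ] H) μ) (hν : End.HasEigenvalue (S : H →ₗ[ℂ] H) ν) :
    ν = μ ∨ ν = -μ := by
  have key : ∀ {μ : ℂ}, End.HasEigenvalue (S : H →ₗ[ℂ] H) μ → μ * μ = p.sign := by
    intro μ hμ
    obtain ⟨x, hx, hx0⟩ := hasEigenvalue_iff.mp hμ
    have h := congrArg (fun A : H →L[ℂ] H => A x) hS
    simp only [mul_apply_eq_comp, p.square_apply, hx, map_smul, smul_smul] at h
    exact smul_left_injective ℂ hx0 h
  exact mul_self_eq_mul_self_iff.mp ((key hν).trans (key hμ).symm)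

/-- A pair of isometries between eigenspaces gives an isometry between eigenspaces of the
direct sum. -/
theorem nonempty_eigenspace_diagOp {S : H →L[ℂ] H} {s : K →L[ℂ] K} {μ ν : ℂ}
    (e : End.eigenspace (S : H →ₗ[ℂ] H) μ ≃ₗᵢ[ℂ] End.eigenspace (S : H →ₗ[ℂ] H) ν)
    (f : End.eigenspace (s : K →ₗ[ℂ] K) μ ≃ₗᵢ[ℂ] End.eigenspace (s : K →ₗ[ℂ] K) ν) :
    Nonempty (End.eigenspace (diagOp S s : DSum H K →ₗ[ℂ] DSum H K) μ ≃ₗᵢ[ℂ]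
      End.eigenspace (diagOp S s : DSum H K →ₗ[ℂ] DSum H K) ν) := by
  have hmem : ∀ (μ : ℂ) (v : DSum H K), v ∈ End.eigenspace (diagOp S s : DSum H K →ₗ[ℂ] DSum H K) μ
      ↔ v.fst ∈ End.eigenspace (S : H →ₗ[ℂ] H) μ ∧ v.snd ∈ End.eigenspace (s : K →ₗ[ℂ] K) μ := by
    rintro μ ⟨x, y⟩
    rw [mem_eigenspace_iff, mem_eigenspace_iff, mem_eigenspace_iff, diagOp_apply]
    exact ⟨fun h => toLp_pair_inj h, fun h => toLp_pair_ext h.1 h.2⟩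
  refine ⟨{ toFun := fun v => ⟨WithLp.toLp 2 ((e ⟨v.1.fst, ((hmem μ _).mp v.2).1⟩ : H),
              (f ⟨v.1.snd, ((hmem μ _).mp v.2).2⟩ : K)),
              (hmem ν _).mpr ⟨(e _).2, (f _).2⟩⟩
            invFun := fun v => ⟨WithLp.toLp 2 ((e.symm ⟨v.1.fst, ((hmem ν _).mp v.2).1⟩ : H),
              (f.symm ⟨v.1.snd, ((hmem ν _).mp v.2).2⟩ : K)),
              (hmem μ _).mpr ⟨(e.symm _).2, (f.symm _).2⟩⟩
            map_add' := fun v w => Subtype.ext (toLp_pair_ext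
              (congrArg Subtype.val (e.map_add ⟨v.1.fst, ((hmem μ _).mp v.2).1⟩
                ⟨w.1.fst, ((hmem μ _).mp w.2).1⟩))
              (congrArg Subtype.val (f.map_add ⟨v.1.snd, ((hmem μ _).mp v.2).2⟩
                ⟨w.1.snd, ((hmem μ _).mp w.2).2⟩)))
            map_smul' := fun c v => Subtype.ext (toLp_pair_ext
              (congrArg Subtype.val (e.map_smul c ⟨v.1.fst, ((hmem μ _).mp v.2).1⟩))
              (congrArg Subtype.val (f.map_smul c ⟨v.1.snd, ((hmem μ _).mp v.2).2⟩)))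
            left_inv := fun v => Subtype.ext (toLp_pair_ext
              (congrArg Subtype.val (e.symm_apply_apply ⟨v.1.fst, ((hmem μ _).mp v.2).1⟩))
              (congrArg Subtype.val (f.symm_apply_apply ⟨v.1.snd, ((hmem μ _).mp v.2).2⟩)))
            right_inv := fun v => Subtype.ext (toLp_pair_ext
              (congrArg Subtype.val (e.apply_symm_apply ⟨v.1.fst, ((hmem ν _).mp v.2).1⟩))
              (congrArg Subtype.val (f.apply_symm_apply ⟨v.1.snd, ((hmem ν _).mp v.2).2⟩)))
            norm_map' := fun v => ?_ }⟩
  have h1 : ‖(e ⟨v.1.fst, ((hmem μ _).mp v.2).1⟩ : H)‖ = ‖v.1.fst‖ := e.norm_map _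
  have h2 : ‖(f ⟨v.1.snd, ((hmem μ _).mp v.2).2⟩ : K)‖ = ‖v.1.snd‖ := f.norm_map _
  change ‖(WithLp.toLp 2 (_, _) : DSum H K)‖ = ‖v.1‖
  rw [WithLp.prod_norm_eq_of_L2, WithLp.prod_norm_eq_of_L2]
  exact congrArg₂ (fun a b : ℝ => √(a ^ 2 + b ^ 2)) h1 h2

theorem hasEigenvalue_diagOp {S : H →L[ℂ] H} {s : K →L[ℂ] K} {μ : ℂ}
    (h : End.HasEigenvalue (diagOp S s : DSum H K →ₗ[ℂ] DSum H K) μ) :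
    End.HasEigenvalue (S : H →ₗ[ℂ] H) μ ∨ End.HasEigenvalue (s : K →ₗ[ℂ] K) μ := by
  obtain ⟨⟨x, y⟩, hv, hv0⟩ := hasEigenvalue_iff.mp h
  rw [diagOp_apply] at hv
  have h1 : S x = μ • x ∧ s y = μ • y := toLp_pair_inj hv
  by_cases hx : x = 0
  · refine Or.inr (hasEigenvalue_iff.mpr ⟨y, h1.2, fun hy => hv0 ?_⟩)
    rw [hx, hy]
    rfl
  · exact Or.inl (hasEigenvalue_iff.mpr ⟨x, h1.1, hx⟩)

variable [CompleteSpace H] [CompleteSpace K]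

/-- A unitary that anticommutes with `S` exchanges the eigenspaces of opposite eigenvalues. -/
theorem nonempty_eigenspace_neg {S Z : H →L[ℂ] H} (hZ : Z ∈ unitary (H →L[ℂ] H))
    (h : Z * S = -(S * Z)) (μ : ℂ) :
    Nonempty (End.eigenspace (S : H →ₗ[ℂ] H) μ ≃ₗᵢ[ℂ] End.eigenspace (S : H →ₗ[ℂ] H) (-μ)) := by
  have h' : ∀ x, S (Z x) = -Z (S x) := fun x => by
    rw [← mul_apply_eq_comp, ← mul_apply_eq_comp, h, _root_.neg_apply, neg_neg]
  have hmaps : ∀ μ : ℂ, ∀ x ∈ End.eigenspace (S : H →ₗ[ℂ] H) μ,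
      Z x ∈ End.eigenspace (S : H →ₗ[ℂ] H) (-μ) := fun μ x hx => by
    rw [mem_eigenspace_iff] at hx ⊢
    rw [h', hx, map_smul, neg_smul]
  have hmaps' : ∀ x ∈ End.eigenspace (S : H →ₗ[ℂ] H) (-μ),
      star Z x ∈ End.eigenspace (S : H →ₗ[ℂ] H) μ := fun x hx => by
    rw [mem_eigenspace_iff] at hx ⊢
    have h1 : Z (S (star Z x)) = Z (μ • star Z x) := by
      rw [← neg_neg (Z (S (star Z x))), ← h', mul_star_apply hZ, hx, map_smul, mul_star_apply hZ,
        neg_smul, neg_neg]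
    exact Function.LeftInverse.injective (star_mul_apply hZ) h1
  exact ⟨{ toLinearEquiv := LinearEquiv.ofLinearMap
              ((Z : H →ₗ[ℂ] H).restrict (hmaps μ)) ((star Z : H →L[ℂ] H).toLinearMap.restrict hmaps')
              (LinearMap.ext fun x => Subtype.ext (mul_star_apply hZ x))
              (LinearMap.ext fun x => Subtype.ext (star_mul_apply hZ x))
           norm_map' := fun x => ContinuousLinearMap.norm_map_of_mem_unitary hZ x.1 }⟩

/-- The only eigenvalues are `μ` and `-μ`, and the anticommuting unitary `Z` exchanges their
eigenspaces. -/
theorem IsSymmetry.of_anticommuting {C : ComplexConj H} {p : Parity} {S Z : H →L[ℂ] H}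
    (hreal : C.bar S = S) (hS : S ∈ _root_.unitary (H →L[ℂ] H)) (hsq : S * S = p.square)
    (hZ : Z ∈ _root_.unitary (H →L[ℂ] H)) (h : Z * S = -(S * Z)) : IsSymmetry C p S where
  real := hreal
  unitary := hS
  square := hsq
  eigenspaces μ ν hμ hν := by
    rcases eigenvalue_eq_or_eq_neg hsq hμ hν with rfl | rfl
    · exact ⟨LinearIsometryEquiv.refl ℂ _⟩
    · exact nonempty_eigenspace_neg hZ h μ

/-- Equal eigenspace dimensions are not inherited by arbitrary sums. The two hypotheses exclude new
eigenvalues from `s` and ensure that it enlarges all eigenspaces of `S` equally, including by zero.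
-/
theorem IsSymmetry.diagOp {C : ComplexConj H} {D : ComplexConj K} {p : Parity} {S : H →L[ℂ] H}
    {s : K →L[ℂ] K} (hS : IsSymmetry C p S) (hs : IsSymmetry D p s)
    (h₁ : ∀ μ, End.HasEigenvalue (s : K →ₗ[ℂ] K) μ → End.HasEigenvalue (S : H →ₗ[ℂ] H) μ)
    (h₂ : ∀ μ ν, End.HasEigenvalue (S : H →ₗ[ℂ] H) μ → End.HasEigenvalue (S : H →ₗ[ℂ] H) ν →
      Nonempty (End.eigenspace (s : K →ₗ[ℂ] K) μ ≃ₗᵢ[ℂ] End.eigenspace (s : K →ₗ[ℂ] K) ν)) :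
    IsSymmetry (C.sum D) p (FUPairing.diagOp S s) where
  real := by rw [bar_diagOp, hS.real, hs.real]
  unitary := diagOp_mem_unitary hS.unitary hs.unitary
  square := by rw [diagOp_mul, hS.square, hs.square, diagOp_square]
  eigenspaces μ ν hμ hν := by
    have hμ' := (hasEigenvalue_diagOp hμ).elim id (h₁ μ)
    have hν' := (hasEigenvalue_diagOp hν).elim id (h₁ ν)
    obtain ⟨e⟩ := hS.eigenspaces μ ν hμ' hν'
    obtain ⟨f⟩ := h₂ μ ν hμ' hν'
    exact nonempty_eigenspace_diagOp e f

theorem IsSymmetry.diagOp_self {C : ComplexConj H} {p : Parity} {S : H →L[ℂ] H}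
    (hS : IsSymmetry C p S) : IsSymmetry (C.sum C) p (FUPairing.diagOp S S) :=
  hS.diagOp hS (fun _ h => h) hS.eigenspaces

end Eigenspaces

/-! ### The symmetry operators behind the types O, S, R, Q -/

section Types

variable {H : Type*} [NormedAddCommGroup H] [InnerProductSpace ℂ H]

theorem bar_blockOp (C : ComplexConj H) (a b c d : H →L[ℂ] H) :
    (C.sum C).bar (blockOp a b c d) = blockOp (C.bar a) (C.bar b) (C.bar c) (C.bar d) :=
  blockOp_ext fun x y => by
    simp only [ComplexConj.bar_apply, sum_apply, blockOp_apply, map_add]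

theorem blockOp_mul_blockOp (a a' b b' c c' d d' : H →L[ℂ] H) :
    blockOp a b c d * blockOp a' b' c' d' =
      blockOp (a * a' + b * c') (a * b' + b * d') (c * a' + d * c') (c * b' + d * d') :=
  blockOp_mul a a' b b' c c' d d'

theorem blockOp_sub (a a' b b' c c' d d' : H →L[ℂ] H) :
    blockOp a b c d - blockOp a' b' c' d' = blockOp (a - a') (b - b') (c - c') (d - d') :=
  blockOp_ext fun x y => by
    rw [_root_.sub_apply, blockOp_apply, blockOp_apply, blockOp_apply, ← WithLp.toLp_sub,
      Prod.mk_sub_mk]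
    exact toLp_pair_ext (by simp only [_root_.sub_apply]; abel)
      (by simp only [_root_.sub_apply]; abel)

theorem smul_blockOp (r : ℂ) (a b c d : H →L[ℂ] H) :
    r • blockOp a b c d = blockOp (r • a) (r • b) (r • c) (r • d) :=
  blockOp_ext fun x y => by
    rw [_root_.smul_apply, blockOp_apply, blockOp_apply, ← WithLp.toLp_smul, Prod.smul_mk]
    exact toLp_pair_ext (by simp only [_root_.smul_apply, smul_add])
      (by simp only [_root_.smul_apply, smul_add])

theorem neg_blockOp (a b c d : H →L[ℂ] H) :
    -blockOp a b c d = blockOp (-a) (-b) (-c) (-d) := by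
  rw [← neg_one_smul ℂ, smul_blockOp]
  simp only [neg_one_smul]

theorem one_eq_blockOp : (1 : DSum H H →L[ℂ] DSum H H) = blockOp 1 0 0 1 := diagOp_one.symm

variable [CompleteSpace H]

theorem blockOp_mem_unitary_iff {a b c d : H →L[ℂ] H} :
    blockOp a b c d ∈ unitary (DSum H H →L[ℂ] DSum H H) ↔
      blockOp (star a * a + star c * c) (star a * b + star c * d) (star b * a + star d * c)
        (star b * b + star d * d) = 1 ∧
      blockOp (a * star a + b * star b) (a * star c + b * star d) (c * star a + d * star b)
        (c * star c + d * star d) = 1 := by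
  rw [Unitary.mem_iff, star_blockOp, blockOp_mul_blockOp, blockOp_mul_blockOp]

theorem bar_mul_of_isReal {C : ComplexConj H} {p : Parity} {S A : H →L[ℂ] H}
    (hS : IsSymmetry C p S) (h : IsReal C S A) :
    C.bar A * S = S * A ∧ C.bar (star A) * S = S * star A := by
  have h1 := (star_mul_mul_eq_iff hS.unitary).mp h
  refine ⟨h1, ?_⟩
  rw [← star_mul_mul_eq_iff hS.unitary]
  rw [IsReal] at h
  conv_rhs => rw [← h, star_mul, star_mul, star_star, star_bar, ← mul_assoc]

theorem bar_mul_of_isSymmetric {C : ComplexConj H} {p : Parity} {S A : H →L[ℂ] H}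
    (hS : IsSymmetry C p S) (h : IsSymmetric C S A) :
    C.bar A * S = S * star A ∧ C.bar (star A) * S = S * A := by
  have h1 := (star_mul_mul_eq_iff hS.unitary).mp h
  rw [ComplexConj.transpose, star_bar] at h1
  refine ⟨?_, h1⟩
  rw [← star_mul_mul_eq_iff hS.unitary]
  rw [IsSymmetric, ComplexConj.transpose] at h
  conv_rhs => rw [← h, star_mul, star_mul, star_star, star_star, ← mul_assoc]

theorem isReal_diagOp_self {C : ComplexConj H} {S A : H →L[ℂ] H} (h : IsReal C S A) :
    IsReal (C.sum C) (diagOp S S) (diagOp A A) := by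
  rw [IsReal, star_diagOp, bar_diagOp, diagOp_mul, diagOp_mul, h]

theorem isSymmetric_diagOp_self {C : ComplexConj H} {S A : H →L[ℂ] H} (h : IsSymmetric C S A) :
    IsSymmetric (C.sum C) (diagOp S S) (diagOp A A) := by
  rw [IsSymmetric, ComplexConj.transpose, star_diagOp, bar_diagOp, star_diagOp, diagOp_mul,
    diagOp_mul]
  rw [IsSymmetric, ComplexConj.transpose] at h
  rw [h]

theorem bar_doubledProj (C : ComplexConj H) (U : H →L[ℂ] H) :
    (C.sum C).bar (doubledProj U) = (1 / 2 : ℂ) • blockOp 1 (C.bar U) (C.bar (star U)) 1 := by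
  have h2 : starRingEnd ℂ (1 / 2) = 1 / 2 := by norm_num [Complex.ext_iff]
  rw [doubledProj, bar_smul, bar_blockOp, bar_one, h2]

theorem isSymmetry_diagOp_neg {C : ComplexConj H} {p : Parity} {S : H →L[ℂ] H}
    (hS : IsSymmetry C p S) : IsSymmetry (C.sum C) p (blockOp S 0 0 (-S)) := by
  have hb0 : C.bar 0 = 0 := by ext v; simp [ComplexConj.bar_apply]
  have hbn : C.bar (-S) = -S := by
    ext v
    rw [ComplexConj.bar_apply, _root_.neg_apply, map_neg, ← ComplexConj.bar_apply, hS.real]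
    rfl
  refine IsSymmetry.of_anticommuting (Z := blockOp 0 1 1 0) ?_ ?_ ?_ ?_ ?_
  · rw [bar_blockOp, hS.real, hb0, hbn]
  · rw [blockOp_mem_unitary_iff]
    simp [Unitary.star_mul_self_of_mem hS.unitary, Unitary.mul_star_self_of_mem hS.unitary,
      one_eq_blockOp]
  · rw [blockOp_mul_blockOp]
    simp only [mul_zero, zero_mul, add_zero, zero_add, neg_mul_neg, hS.square]
    exact diagOp_square p
  · rw [blockOp_mem_unitary_iff]
    simp [one_eq_blockOp]
  · rw [blockOp_mul_blockOp, blockOp_mul_blockOp, neg_blockOp]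
    simp

theorem isSymmetry_offdiag {C : ComplexConj H} {p : Parity} {S : H →L[ℂ] H}
    (hS : IsSymmetry C p S) : IsSymmetry (C.sum C) p (blockOp 0 S S 0) := by
  have hb0 : C.bar 0 = 0 := by ext v; simp [ComplexConj.bar_apply]
  refine IsSymmetry.of_anticommuting (Z := blockOp 1 0 0 (-1)) ?_ ?_ ?_ ?_ ?_
  · rw [bar_blockOp, hS.real, hb0]
  · rw [blockOp_mem_unitary_iff]
    simp [Unitary.star_mul_self_of_mem hS.unitary, Unitary.mul_star_self_of_mem hS.unitary,
      one_eq_blockOp]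
  · rw [blockOp_mul_blockOp]
    simp only [mul_zero, zero_mul, add_zero, zero_add, hS.square]
    exact diagOp_square p
  · rw [blockOp_mem_unitary_iff]
    simp [one_eq_blockOp]
  · rw [blockOp_mul_blockOp, blockOp_mul_blockOp, neg_blockOp]
    simp

/-- Conjugation by `S ⊕ (-S)` flips the sign of the off-diagonal blocks, turning `P` into `1 - P`.
-/
theorem isLagrangian_diagOp_neg {C : ComplexConj H} {p : Parity} {S U : H →L[ℂ] H}
    (hS : IsSymmetry C p S) (h : IsReal C S U) :
    IsLagrangian (C.sum C) (blockOp S 0 0 (-S)) (doubledProj U) := by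
  obtain ⟨h1, h2⟩ := bar_mul_of_isReal hS h
  rw [IsLagrangian, star_mul_mul_eq_iff (isSymmetry_diagOp_neg hS).unitary, bar_doubledProj,
    doubledProj, smul_mul_assoc, one_eq_blockOp, smul_blockOp, blockOp_sub, blockOp_mul_blockOp,
    blockOp_mul_blockOp, smul_blockOp]
  simp only [mul_zero, zero_mul, add_zero, zero_add, one_mul, mul_neg, h1, h2, zero_sub,
    mul_sub, mul_one, mul_smul_comm, neg_mul, smul_neg, neg_neg, smul_zero, sub_zero, neg_zero]
  congr 1
  · module
  · module

/-- The off-diagonal `S` interchanges the blocks `U` and `U^*`, compensating the adjoint in the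
relation for `U`. -/
theorem isReal_offdiag {C : ComplexConj H} {p : Parity} {S U : H →L[ℂ] H}
    (hS : IsSymmetry C p S) (h : IsSymmetric C S U) :
    IsReal (C.sum C) (blockOp 0 S S 0) (doubledProj U) := by
  obtain ⟨h1, h2⟩ := bar_mul_of_isSymmetric hS h
  rw [IsReal, star_mul_mul_eq_iff (isSymmetry_offdiag hS).unitary, bar_doubledProj,
    doubledProj, smul_mul_assoc, mul_smul_comm, blockOp_mul_blockOp, blockOp_mul_blockOp]
  simp [h1, h2]

omit [CompleteSpace H] in
theorem commute_blockOp_diagOp {S A : H →L[ℂ] H} (h : Commute S A) :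
    Commute (blockOp S 0 0 (-S)) (diagOp A A) ∧ Commute (blockOp 0 S S 0) (diagOp A A) := by
  constructor
  · rw [Commute, SemiconjBy, diagOp, blockOp_mul_blockOp, blockOp_mul_blockOp]
    simp [h.eq]
  · rw [Commute, SemiconjBy, diagOp, blockOp_mul_blockOp, blockOp_mul_blockOp]
    simp [h.eq]

theorem IsPairing.hasType {C : ComplexConj H} {j : Row} {d : Col} {S Sig U F : H →L[ℂ] H}
    (h : IsPairing C j d S Sig U F) {τ : IndexType} (hτ : entry j d = some τ) :
    HasType (C.sum C) τ (diagOp Sig Sig) (doubledProj U) (diagOp F F) := by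
  have hS := h.symm_S
  have hΘ := h.symm_Sig.diagOp_self
  have hU := h.rel_S
  have hF := h.rel_Sig
  have c1 := commute_blockOp_diagOp h.comm_S_Sig
  have c2 := commute_blockOp_diagOp h.comm_S_F
  have c3 := h.comm_Sig_P
  cases j <;> cases d <;> cases hτ
  · exact ⟨_, ⟨isSymmetry_diagOp_neg hS, isLagrangian_diagOp_neg hS hU, hΘ,
      isReal_diagOp_self hF⟩, c1.1, c2.1, c3⟩
  · exact ⟨_, ⟨isSymmetry_offdiag hS, isReal_offdiag hS hU, hΘ,
      isSymmetric_diagOp_self hF⟩, c1.2, c2.2, c3⟩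
  · exact ⟨_, ⟨isSymmetry_diagOp_neg hS, isLagrangian_diagOp_neg hS hU, hΘ,
      isReal_diagOp_self hF⟩, c1.1, c2.1, c3⟩
  · exact ⟨_, ⟨isSymmetry_offdiag hS, isReal_offdiag hS hU, hΘ,
      isSymmetric_diagOp_self hF⟩, c1.2, c2.2, c3⟩

end Types

/-! ### The antiunitary of a pairing and the case distinction of the table -/

section Pairings

variable {H : Type*} [NormedAddCommGroup H] [InnerProductSpace ℂ H] [CompleteSpace H]
  {C : ComplexConj H} {j : Row} {d : Col} {S Sig U F : H →L[ℂ] H}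

theorem IsPairing.commute_Sig_U (h : IsPairing C j d S Sig U F) : Commute Sig U :=
  (commute_diagOp_doubledProj_iff h.unitary_U).mp h.comm_Sig_P

theorem IsPairing.isFredholm_anticomm (h : IsPairing C j d S Sig U F) :
    (anticomm U F).IsFredholm :=
  (isFredholm_pairingOp_iff h.unitary_U F).mp h.fredholm

variable (h : IsPairing C j d S Sig U F) (hSS : S * Sig ∈ unitary (H →L[ℂ] H))

include h

/-- `S` and `Σ` are real and commute, so `(S Σ C)² = S² Σ²`. -/
theorem IsPairing.antiunitary_antiunitary (v : H) :
    antiunitary C hSS (antiunitary C hSS v) = (j.parity.sign * d.parity.sign) • v := by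
  have hc : ∀ w, S (Sig w) = Sig (S w) := fun w => congrArg (fun A : H →L[ℂ] H => A w) h.comm_S_Sig
  simp only [antiunitary_apply, mul_apply_eq_comp, h.symm_S.conj_apply, h.symm_Sig.conj_apply,
    C.involutive]
  rw [hc, h.symm_S.apply_apply, map_smul, h.symm_Sig.apply_apply, smul_smul]

/-- `S C` carries the relation for `U`, and `Σ` commutes with `U`; for `F` below the roles of `S`
and `Σ` are exchanged. -/
theorem IsPairing.apply_antiunitary_of_isReal_left (hU : IsReal C S U) (v : H) :
    U (antiunitary C hSS v) = antiunitary C hSS (U v) := by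
  rw [isReal_iff h.symm_S] at hU
  rw [antiunitary_apply, antiunitary_apply, h.comm_S_Sig.eq, mul_apply_eq_comp, mul_apply_eq_comp,
    ← hU, ← mul_apply_eq_comp U, ← h.commute_Sig_U.eq, mul_apply_eq_comp]

theorem IsPairing.star_apply_antiunitary_of_isSymmetric_left (hU : IsSymmetric C S U) (v : H) :
    star U (antiunitary C hSS v) = antiunitary C hSS (U v) := by
  rw [isSymmetric_iff h.symm_S] at hU
  rw [antiunitary_apply, antiunitary_apply, h.comm_S_Sig.eq, mul_apply_eq_comp, mul_apply_eq_comp,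
    ← hU, ← mul_apply_eq_comp (star U),
    ← (commute_star_of_mem_unitary h.unitary_U h.commute_Sig_U).eq, mul_apply_eq_comp]

theorem IsPairing.apply_antiunitary_of_isReal_right (hF : IsReal C Sig F) (v : H) :
    F (antiunitary C hSS v) = antiunitary C hSS (F v) := by
  rw [isReal_iff h.symm_Sig] at hF
  rw [antiunitary_apply, antiunitary_apply, mul_apply_eq_comp, mul_apply_eq_comp,
    ← hF, ← mul_apply_eq_comp F, ← h.comm_S_F.eq, mul_apply_eq_comp]

theorem IsPairing.star_apply_antiunitary_of_isSymmetric_right (hF : IsSymmetric C Sig F) (v : H) :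
    star F (antiunitary C hSS v) = antiunitary C hSS (F v) := by
  rw [isSymmetric_iff h.symm_Sig] at hF
  rw [antiunitary_apply, antiunitary_apply, mul_apply_eq_comp, mul_apply_eq_comp,
    ← hF, ← mul_apply_eq_comp (star F),
    ← (commute_star_of_mem_unitary h.unitary_F h.comm_S_F).eq, mul_apply_eq_comp]

/-- The nonzero entries are exactly those with two real unitaries and `J² = 1`, or two symmetric
ones and `J² = -1`. -/
theorem IsPairing.isWellDefined {τ : IndexType} (hτ : entry j d = some τ) :
    IsWellDefined C j d S Sig U F := by
  intro γ hγ hp t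
  have hSS := mul_mem h.symm_S.unitary h.symm_Sig.unitary
  have hUc : Continuous fun t => (γ t).1 := continuous_fst.comp γ.continuous
  have hFc : Continuous fun t => (γ t).2 := continuous_snd.comp γ.continuous
  have hfred := fun t => (hp t).isFredholm_anticomm
  have hJ := h.antiunitary_antiunitary hSS
  suffices hconst : IsLocallyConstant fun t =>
      (finrank ℂ (anticomm (γ t).1 (γ t).2).ker : ZMod 2) by
    have h1 : (finrank ℂ (anticomm (γ t).1 (γ t).2).ker : ZMod 2) =
        finrank ℂ (anticomm (γ 0).1 (γ 0).2).ker := hconst.apply_eq_of_preconnectedSpace t 0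
    rw [hγ] at h1
    rwa [index₂_pairingOp (hp t).unitary_U, index₂_pairingOp h.unitary_U]
  have hreal : ∀ (hj : ∀ t, IsReal C S (γ t).1) (hd : ∀ t, IsReal C Sig (γ t).2)
      (hs : j.parity.sign * d.parity.sign = 1), IsLocallyConstant fun t =>
      (finrank ℂ (anticomm (γ t).1 (γ t).2).ker : ZMod 2) := fun hj hd hs =>
    isLocallyConstant_of_real_real hUc hFc (fun t => (hp t).unitary_U) (fun t => (hp t).unitary_F)
      (antiunitary C hSS) hfred (fun v => by rw [hJ, hs, one_smul])
      (fun t => (hp t).apply_antiunitary_of_isReal_left hSS (hj t))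
      (fun t => (hp t).apply_antiunitary_of_isReal_right hSS (hd t))
  have hsymm : ∀ (hj : ∀ t, IsSymmetric C S (γ t).1) (hd : ∀ t, IsSymmetric C Sig (γ t).2)
      (hs : j.parity.sign * d.parity.sign = -1), IsLocallyConstant fun t =>
      (finrank ℂ (anticomm (γ t).1 (γ t).2).ker : ZMod 2) := fun hj hd hs =>
    isLocallyConstant_of_symmetric_symmetric hUc hFc
      (antiunitary C hSS) hfred (fun v => by rw [hJ, hs, neg_one_smul])
      (fun t => (hp t).star_apply_antiunitary_of_isSymmetric_left hSS (hj t))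
      (fun t => (hp t).star_apply_antiunitary_of_isSymmetric_right hSS (hd t))
  have hU := fun t => (hp t).rel_S
  have hF := fun t => (hp t).rel_Sig
  cases j <;> cases d <;> cases hτ
  · exact hreal hU hF (by norm_num [Row.parity, Col.parity, Parity.sign])
  · exact hsymm hU hF (by norm_num [Row.parity, Col.parity, Parity.sign])
  · exact hreal hU hF (by norm_num [Row.parity, Col.parity, Parity.sign])
  · exact hsymm hU hF (by norm_num [Row.parity, Col.parity, Parity.sign])

/-- At an entry `0`, the index vanishes by Kramers degeneracy unless `U` and `F` have different
kinds of symmetries of the same parity. -/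
theorem IsPairing.index₂_eq_zero_or (h0 : entry j d = none) :
    index₂ (pairingOp U F) = 0 ∨ j = .j1 ∧ d = .d2 ∨ j = .j5 ∧ d = .d6 ∨ j = .j3 ∧ d = .d4 ∨
      j = .j7 ∧ d = .d8 := by
  have hSS := mul_mem h.symm_S.unitary h.symm_Sig.unitary
  have hJ := h.antiunitary_antiunitary hSS
  have hfin : FiniteDimensional ℂ (anticomm U F).ker := h.isFredholm_anticomm.finite_ker
  have hU := h.rel_S
  have hF := h.rel_Sig
  rw [index₂_pairingOp h.unitary_U]
  have hrr : ∀ (_ : IsReal C S U) (_ : IsReal C Sig F) (_ : j.parity.sign * d.parity.sign = -1),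
      Even (finrank ℂ (anticomm U F).ker) := fun hj hd hs =>
    even_finrank_ker_of_real_real (antiunitary C hSS) (fun v => by rw [hJ, hs, neg_one_smul])
      (h.apply_antiunitary_of_isReal_left hSS hj) (h.apply_antiunitary_of_isReal_right hSS hd)
  have hrs : ∀ (_ : IsReal C S U) (_ : IsSymmetric C Sig F)
      (_ : j.parity.sign * d.parity.sign = -1),
      Even (finrank ℂ (anticomm U F).ker) := fun hj hd hs =>
    even_finrank_ker_of_real_symmetric h.unitary_F (antiunitary C hSS)
      (fun v => by rw [hJ, hs, neg_one_smul]) (h.apply_antiunitary_of_isReal_left hSS hj)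
      (h.star_apply_antiunitary_of_isSymmetric_right hSS hd)
  have hsr : ∀ (_ : IsSymmetric C S U) (_ : IsReal C Sig F)
      (_ : j.parity.sign * d.parity.sign = -1),
      Even (finrank ℂ (anticomm U F).ker) := fun hj hd hs =>
    even_finrank_ker_of_symmetric_real h.unitary_U (antiunitary C hSS)
      (fun v => by rw [hJ, hs, neg_one_smul])
      (h.star_apply_antiunitary_of_isSymmetric_left hSS hj)
      (h.apply_antiunitary_of_isReal_right hSS hd)
  have hss : ∀ (_ : IsSymmetric C S U) (_ : IsSymmetric C Sig F)
      (_ : j.parity.sign * d.parity.sign = 1),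
      Even (finrank ℂ (anticomm U F).ker) := fun hj hd hs =>
    even_finrank_ker_of_symmetric_symmetric h.unitary_U h.unitary_F (antiunitary C hSS)
      (fun v => by rw [hJ, hs, one_smul])
      (h.star_apply_antiunitary_of_isSymmetric_left hSS hj)
      (h.star_apply_antiunitary_of_isSymmetric_right hSS hd)
  -- The first two alternatives discard the nonzero entries and keep the four mixed cases with `J² =
  -- 1`; the rest is Kramers degeneracy, selected by the kinds of `U` and `F`.
  cases j <;> cases d <;> first
    | (exfalso; simp [entry] at h0; done)
    | (right; simp; done)
    | (left; refine (hrr hU hF ?_).natCast_zmod_two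
       norm_num [Row.parity, Col.parity, Parity.sign])
    | (left; refine (hrs hU hF ?_).natCast_zmod_two
       norm_num [Row.parity, Col.parity, Parity.sign])
    | (left; refine (hsr hU hF ?_).natCast_zmod_two
       norm_num [Row.parity, Col.parity, Parity.sign])
    | (left; refine (hss hU hF ?_).natCast_zmod_two
       norm_num [Row.parity, Col.parity, Parity.sign])

end Pairings

/-! ### Direct sums of pairings and paths in the added summand -/

section DirectSum

variable {H K : Type*} [NormedAddCommGroup H] [InnerProductSpace ℂ H] [CompleteSpace H]
  [NormedAddCommGroup K] [InnerProductSpace ℂ K] [CompleteSpace K]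

theorem IsReal.diagOp {C : ComplexConj H} {D : ComplexConj K} {S A : H →L[ℂ] H} {s a : K →L[ℂ] K}
    (h : IsReal C S A) (h' : IsReal D s a) :
    IsReal (C.sum D) (FUPairing.diagOp S s) (FUPairing.diagOp A a) := by
  rw [IsReal, star_diagOp, bar_diagOp, diagOp_mul, diagOp_mul, h, h']

theorem IsSymmetric.diagOp {C : ComplexConj H} {D : ComplexConj K} {S A : H →L[ℂ] H}
    {s a : K →L[ℂ] K} (h : IsSymmetric C S A) (h' : IsSymmetric D s a) :
    IsSymmetric (C.sum D) (FUPairing.diagOp S s) (FUPairing.diagOp A a) := by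
  rw [IsSymmetric, ComplexConj.transpose] at *
  rw [star_diagOp, bar_diagOp, star_diagOp, diagOp_mul, diagOp_mul, h, h']

omit [CompleteSpace H] [CompleteSpace K] in
theorem commute_diagOp {A B : H →L[ℂ] H} {a b : K →L[ℂ] K} (h : Commute A B) (h' : Commute a b) :
    Commute (diagOp A a) (diagOp B b) := by
  rw [Commute, SemiconjBy, diagOp_mul, diagOp_mul, h.eq, h'.eq]

omit [CompleteSpace H] [CompleteSpace K] in
theorem anticomm_diagOp (U F : H →L[ℂ] H) (u f : K →L[ℂ] K) :
    anticomm (diagOp U u) (diagOp F f) = diagOp (anticomm U F) (anticomm u f) := by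
  simp only [anticomm, diagOp_mul, diagOp_add]

theorem IsPairing.diagOp [FiniteDimensional ℂ K] {C : ComplexConj H} {D : ComplexConj K}
    {j : Row} {d : Col} {S Sig U F : H →L[ℂ] H} {s sig u f : K →L[ℂ] K}
    (h : IsPairing C j d S Sig U F) (h' : IsPairing D j d s sig u f)
    (hS : IsSymmetry (C.sum D) j.parity (FUPairing.diagOp S s))
    (hSig : IsSymmetry (C.sum D) d.parity (FUPairing.diagOp Sig sig)) :
    IsPairing (C.sum D) j d (FUPairing.diagOp S s) (FUPairing.diagOp Sig sig)
      (FUPairing.diagOp U u) (FUPairing.diagOp F f) where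
  unitary_U := diagOp_mem_unitary h.unitary_U h'.unitary_U
  unitary_F := diagOp_mem_unitary h.unitary_F h'.unitary_F
  symm_S := hS
  symm_Sig := hSig
  rel_S := by
    have h1 := h.rel_S
    have h2 := h'.rel_S
    cases j
    · exact IsReal.diagOp h1 h2
    · exact IsSymmetric.diagOp h1 h2
    · exact IsReal.diagOp h1 h2
    · exact IsSymmetric.diagOp h1 h2
  rel_Sig := by
    have h1 := h.rel_Sig
    have h2 := h'.rel_Sig
    cases d
    · exact IsSymmetric.diagOp h1 h2
    · exact IsReal.diagOp h1 h2
    · exact IsSymmetric.diagOp h1 h2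
    · exact IsReal.diagOp h1 h2
  comm_S_Sig := commute_diagOp h.comm_S_Sig h'.comm_S_Sig
  comm_S_F := commute_diagOp h.comm_S_F h'.comm_S_F
  comm_Sig_P := (commute_diagOp_doubledProj_iff (diagOp_mem_unitary h.unitary_U h'.unitary_U)).mpr
    (commute_diagOp h.commute_Sig_U h'.commute_Sig_U)
  fredholm := by
    rw [isFredholm_pairingOp_iff (diagOp_mem_unitary h.unitary_U h'.unitary_U), anticomm_diagOp]
    exact isFredholm_diagOp h.isFredholm_anticomm _

theorem index₂_pairingOp_diagOp [FiniteDimensional ℂ K] {U F : H →L[ℂ] H} {u f : K →L[ℂ] K}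
    (hU : U ∈ unitary (H →L[ℂ] H)) (hu : u ∈ unitary (K →L[ℂ] K))
    [FiniteDimensional ℂ (anticomm U F).ker] :
    index₂ (pairingOp (diagOp U u) (diagOp F f)) =
      index₂ (pairingOp U F) + index₂ (pairingOp u f) := by
  rw [index₂_pairingOp (diagOp_mem_unitary hU hu), index₂_pairingOp hU, index₂_pairingOp hu,
    anticomm_diagOp, finrank_ker_diagOp, Nat.cast_add]

omit [CompleteSpace K] in
theorem isFredholm_of_finiteDimensional [FiniteDimensional ℂ K] (T : K →L[ℂ] K) :
    T.IsFredholm := by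
  rw [isFredholm_iff_exists_mul_sub_one]
  exact ⟨0, LinearMap.HasFiniteRange.of_finite_dom, LinearMap.HasFiniteRange.of_finite_dom⟩

/-- Only the `F` of the finite-dimensional summand moves. The indices add, so it suffices that the
index at the end of the added path cancels that of the given pairing. -/
theorem IsPairing.exists_path [FiniteDimensional ℂ K] {C : ComplexConj H} {D : ComplexConj K}
    {j : Row} {d : Col} {S Sig U F : H →L[ℂ] H} (h : IsPairing C j d S Sig U F)
    {s sig u : K →L[ℂ] K} (f : unitInterval → K →L[ℂ] K)
    (hf : Continuous f) (hf0 : f 0 = 1) (hp : ∀ t, IsPairing D j d s sig u (f t))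
    (hS : IsSymmetry (C.sum D) j.parity (FUPairing.diagOp S s))
    (hSig : IsSymmetry (C.sum D) d.parity (FUPairing.diagOp Sig sig))
    (hodd : index₂ (pairingOp U F) + index₂ (pairingOp u (f 1)) = 0) :
    ∃ γ : C(unitInterval, (DSum H K →L[ℂ] DSum H K) × (DSum H K →L[ℂ] DSum H K)),
      γ 0 = (FUPairing.diagOp U u, FUPairing.diagOp F 1) ∧
      (∀ t, IsPairing (C.sum D) j d (FUPairing.diagOp S s) (FUPairing.diagOp Sig sig)
        (γ t).1 (γ t).2) ∧
      index₂ (pairingOp (γ 1).1 (γ 1).2) = 0 := by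
  refine ⟨⟨fun t => (FUPairing.diagOp U u, FUPairing.diagOp F (f t)), ?_⟩, ?_, ?_, ?_⟩
  · have h1 : Continuous fun t => (F, f t) := continuous_const.prodMk hf
    have h2 : Continuous fun t => FUPairing.diagOp F (f t) :=
      Continuous.comp (f := fun t => (F, f t)) continuous_diagOp h1
    exact Continuous.prodMk continuous_const h2
  · exact congrArg (fun a => (FUPairing.diagOp U u, FUPairing.diagOp F a)) hf0
  · exact fun t => h.diagOp (hp t) hS hSig
  · have : FiniteDimensional ℂ (anticomm U F).ker := h.isFredholm_anticomm.finite_ker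
    exact (index₂_pairingOp_diagOp h.unitary_U (hp 1).unitary_U).trans hodd

/-- When the index already vanishes, the zero space suffices: there `1 = -1` is a symmetry of either
parity, having no eigenvalues. -/
theorem IsPairing.exists_path_of_subsingleton [Subsingleton K] {C : ComplexConj H}
    (D : ComplexConj K) {j : Row} {d : Col} {S Sig U F : H →L[ℂ] H}
    (h : IsPairing C j d S Sig U F) (h0 : index₂ (pairingOp U F) = 0) :
    ∃ γ : C(unitInterval, (DSum H K →L[ℂ] DSum H K) × (DSum H K →L[ℂ] DSum H K)),
      γ 0 = (FUPairing.diagOp U 1, FUPairing.diagOp F 1) ∧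
      (∀ t, IsPairing (C.sum D) j d (FUPairing.diagOp S 1) (FUPairing.diagOp Sig 1)
        (γ t).1 (γ t).2) ∧
      index₂ (pairingOp (γ 1).1 (γ 1).2) = 0 := by
  have : Subsingleton (K →L[ℂ] K) := ⟨fun A B => ContinuousLinearMap.ext fun x =>
    Subsingleton.elim _ _⟩
  have heig : ∀ μ : ℂ, ¬ End.HasEigenvalue ((1 : K →L[ℂ] K) : K →ₗ[ℂ] K) μ := fun μ hμ => by
    obtain ⟨x, -, hx⟩ := hasEigenvalue_iff.mp hμ
    exact hx (Subsingleton.elim _ _)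
  have hsymm : ∀ p, IsSymmetry D p 1 := fun p =>
    ⟨Subsingleton.elim _ _, one_mem _, Subsingleton.elim _ _, fun μ _ hμ => absurd hμ (heig μ)⟩
  have hsum : ∀ {p : Parity} {T : H →L[ℂ] H}, IsSymmetry C p T →
      IsSymmetry (C.sum D) p (FUPairing.diagOp T 1) := fun {p T} hT =>
    hT.diagOp (hsymm p) (fun μ hμ => absurd hμ (heig μ)) fun μ ν _ _ =>
      ⟨{ toLinearEquiv := 0
         norm_map' := fun x => by rw [Subsingleton.elim x 0, map_zero, norm_zero, norm_zero] }⟩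
  have hp : IsPairing D j d 1 1 1 1 :=
    { unitary_U := one_mem _
      unitary_F := one_mem _
      symm_S := hsymm _
      symm_Sig := hsymm _
      rel_S := by cases j <;> exact Subsingleton.elim _ _
      rel_Sig := by cases d <;> exact Subsingleton.elim _ _
      comm_S_Sig := Commute.one_left _
      comm_S_F := Commute.one_left _
      comm_Sig_P := by rw [diagOp_one]; exact Commute.one_left _
      fredholm := isFredholm_of_finiteDimensional _ }
  refine h.exists_path (fun _ => 1) continuous_const rfl (fun _ => hp)
    (hsum h.symm_S) (hsum h.symm_Sig) ?_
  rw [h0, zero_add, index₂_pairingOp (one_mem _), finrank_zero_of_subsingleton, Nat.cast_zero]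

theorem IsPairing.isTrivializable_of_index₂_eq_zero {C : ComplexConj H} {j : Row} {d : Col}
    {S Sig U F : H →L[ℂ] H} (h : IsPairing C j d S Sig U F) (h0 : index₂ (pairingOp U F) = 0) :
    IsTrivializable C j d S Sig U F :=
  ⟨0, 1, 1, 1, h.exists_path_of_subsingleton (stdConj 0) h0⟩

end DirectSum

/-! ### Augmenting symmetry operators -/

section Models

variable {H K : Type*} [NormedAddCommGroup H] [InnerProductSpace ℂ H] [CompleteSpace H]
  [NormedAddCommGroup K] [InnerProductSpace ℂ K] [CompleteSpace K]

omit [CompleteSpace H] in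
theorem hasEigenvalue_of_apply {S : H →L[ℂ] H} {μ : ℂ} (x : H) (hx : S x = μ • x) (h0 : x ≠ 0) :
    End.HasEigenvalue (S : H →ₗ[ℂ] H) μ := hasEigenvalue_iff.mpr ⟨x, hx, h0⟩

/-- A symmetry operator is a scalar or has both possible eigenvalues. -/
theorem IsSymmetry.eq_smul_one_or {C : ComplexConj H} {p : Parity} {S : H →L[ℂ] H} [Nontrivial H]
    (hS : IsSymmetry C p S) :
    (∃ c : ℂ, p = .even ∧ c * c = 1 ∧ starRingEnd ℂ c = c ∧ S = c • 1) ∨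
      ∀ μ : ℂ, μ * μ = p.sign → End.HasEigenvalue (S : H →ₗ[ℂ] H) μ := by
  have hsq := hS.apply_apply
  cases p with
  | even =>
    simp only [Parity.sign, one_smul] at hsq
    by_cases h1 : S = (1 : ℂ) • 1
    · exact Or.inl ⟨1, rfl, by norm_num, by simp, h1⟩
    by_cases h2 : S = (-1 : ℂ) • 1
    · exact Or.inl ⟨-1, rfl, by norm_num, by simp, h2⟩
    right
    intro μ hμ
    obtain ⟨v, hv⟩ := DFunLike.ne_iff.mp h1
    obtain ⟨w, hw⟩ := DFunLike.ne_iff.mp h2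
    rcases mul_self_eq_one_iff.mp hμ with rfl | rfl
    · refine hasEigenvalue_of_apply (S w + w) (by rw [map_add, hsq, one_smul, add_comm])
        fun h => hw ?_
      rw [neg_one_smul]
      exact eq_neg_of_add_eq_zero_left h
    · refine hasEigenvalue_of_apply (S v - v)
        (by rw [map_sub, hsq, neg_one_smul, neg_sub]) fun h => hv ?_
      rw [one_smul]
      exact sub_eq_zero.mp h
  | odd =>
    right
    simp only [Parity.sign, neg_one_smul] at hsq
    -- A real operator has conjugation-invariant eigenvalues, so an odd symmetry has both `i` and
    -- `-i`.
    have hconj : ∀ μ : ℂ, End.HasEigenvalue (S : H →ₗ[ℂ] H) μ →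
        End.HasEigenvalue (S : H →ₗ[ℂ] H) (starRingEnd ℂ μ) := fun μ hμ => by
      obtain ⟨x, hx, hx0⟩ := hasEigenvalue_iff.mp hμ
      refine hasEigenvalue_of_apply (C.toMap x)
        (by rw [← hS.conj_apply, hx, C.toMap.map_smulₛₗ]) fun h => hx0 ?_
      exact C.toMap.injective (by rw [h, map_zero])
    have hI : End.HasEigenvalue (S : H →ₗ[ℂ] H) Complex.I := by
      obtain ⟨w, hw⟩ := exists_ne (0 : H)
      by_cases h : S w + Complex.I • w = 0
      · have := hconj (-Complex.I) (hasEigenvalue_of_apply w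
          (by rw [neg_smul]; exact eq_neg_of_add_eq_zero_left h) hw)
        simpa using this
      · refine hasEigenvalue_of_apply _ ?_ h
        rw [map_add, hsq, map_smul, smul_add, smul_smul, Complex.I_mul_I, neg_one_smul, add_comm]
    intro μ hμ
    have hμI : μ * μ = Complex.I * Complex.I := by rw [hμ, Complex.I_mul_I]; rfl
    rcases mul_self_eq_mul_self_iff.mp hμI with rfl | rfl
    · exact hI
    · simpa using hconj _ hI

omit [CompleteSpace H] in
theorem hasEigenvalue_smul_one {c μ : ℂ}
    (h : End.HasEigenvalue ((c • 1 : H →L[ℂ] H) : H →ₗ[ℂ] H) μ) : μ = c := by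
  obtain ⟨x, hx, hx0⟩ := hasEigenvalue_iff.mp h
  exact (smul_left_injective ℂ hx0 hx).symm

/-- Every symmetry operator can be augmented by one in the image of the `2 × 2` matrices. -/
theorem IsSymmetry.exists_augmentation {C : ComplexConj H} {p : Parity} {S : H →L[ℂ] H}
    [Nontrivial H] (hS : IsSymmetry C p S) (D : ComplexConj K)
    (g : Matrix (Fin 2) (Fin 2) ℂ →⋆ₐ[ℂ] (K →L[ℂ] K))
    (hg : ∀ x, D.bar (g x) = g (x.map (starRingEnd ℂ))) :
    ∃ x, IsSymmetry D p (g x) ∧ IsSymmetry (C.sum D) p (FUPairing.diagOp S (g x)) := by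
  -- A scalar `S` has a single eigenvalue, so the added symmetry must be the same scalar.
  rcases hS.eq_smul_one_or with ⟨c, rfl, hcc, hc, rfl⟩ | hall
  · have hgc : g (c • 1) = c • 1 := by rw [map_smul, map_one]
    have h1 : IsSymmetry D .even (c • 1 : K →L[ℂ] K) :=
      { real := by rw [bar_smul, bar_one, hc]
        unitary := by
          rw [Unitary.mem_iff, star_smul, star_one, smul_mul_smul_comm, smul_mul_smul_comm, mul_one,
            Complex.star_def, hc, hcc, one_smul]
          exact ⟨rfl, rfl⟩
        square := by
          rw [smul_mul_smul_comm, hcc, one_smul, mul_one]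
          rfl
        eigenspaces := fun μ ν hμ hν => by
          rw [hasEigenvalue_smul_one hμ, hasEigenvalue_smul_one hν]
          exact ⟨LinearIsometryEquiv.refl ℂ _⟩ }
    refine ⟨c • 1, hgc ▸ h1, hgc ▸ hS.diagOp h1 (fun μ hμ => ?_) fun μ ν hμ hν => ?_⟩
    · rw [hasEigenvalue_smul_one hμ]
      obtain ⟨w, hw⟩ := exists_ne (0 : H)
      exact hasEigenvalue_of_apply w rfl hw
    · rw [hasEigenvalue_smul_one hμ, hasEigenvalue_smul_one hν]
      exact ⟨LinearIsometryEquiv.refl ℂ _⟩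
  -- Otherwise `S` has both eigenvalues, and any real `2 × 2` symmetry `x` with an anticommuting
  -- unitary `z` will do: its two eigenspaces have equal dimension.
  · obtain ⟨x, z, hxr, hx1, hx2, hxx, hz1, hz2, hzx⟩ : ∃ x z : Matrix (Fin 2) (Fin 2) ℂ,
        x.map (starRingEnd ℂ) = x ∧ star x * x = 1 ∧ x * star x = 1 ∧ x * x = p.sign • 1 ∧
        star z * z = 1 ∧ z * star z = 1 ∧ z * x = -(x * z) := by
      cases p
      · refine ⟨!![1, 0; 0, -1], !![0, 1; 1, 0], ?_, ?_, ?_, ?_, ?_, ?_, ?_⟩ <;>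
          ext i j <;> fin_cases i <;> fin_cases j <;>
          simp [Matrix.mul_apply, Fin.sum_univ_two, Parity.sign, Matrix.star_apply]
      · refine ⟨!![0, -1; 1, 0], !![1, 0; 0, -1], ?_, ?_, ?_, ?_, ?_, ?_, ?_⟩ <;>
          ext i j <;> fin_cases i <;> fin_cases j <;>
          simp [Matrix.mul_apply, Fin.sum_univ_two, Parity.sign, Matrix.star_apply]
    have hz : g z ∈ _root_.unitary (K →L[ℂ] K) := by
      rw [Unitary.mem_iff, ← map_star, ← map_mul, ← map_mul, hz1, hz2, map_one]
      exact ⟨rfl, rfl⟩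
    have hzx' : g z * g x = -(g x * g z) := by rw [← map_mul, ← map_mul, hzx, map_neg]
    have hxx' : g x * g x = p.square := by
      rw [← map_mul, hxx, map_smul, map_one, p.square_eq]
    have h1 : IsSymmetry D p (g x) := by
      refine IsSymmetry.of_anticommuting (by rw [hg, hxr]) ?_ hxx' hz hzx'
      rw [Unitary.mem_iff, ← map_star, ← map_mul, ← map_mul, hx1, hx2, map_one]
      exact ⟨rfl, rfl⟩
    refine ⟨x, h1, hS.diagOp h1 (fun μ hμ => hall μ ?_) fun μ ν hμ hν => ?_⟩
    · obtain ⟨v, hv, hv0⟩ := hasEigenvalue_iff.mp hμ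
      have h2 := h1.apply_apply v
      rw [hv, map_smul, hv, smul_smul] at h2
      exact smul_left_injective ℂ hv0 h2
    · rcases eigenvalue_eq_or_eq_neg hS.square hμ hν with rfl | rfl
      · exact ⟨LinearIsometryEquiv.refl ℂ _⟩
      · exact nonempty_eigenspace_neg hz hzx' μ

end Models

/-! ### Conjugating the plain conjugation into a twisted one -/

section Twist

variable {H : Type*} [NormedAddCommGroup H] [InnerProductSpace ℂ H] [CompleteSpace H]

/-- A unitary square root of a self-adjoint involution. -/
def sqrtInvolution (Γ : H →L[ℂ] H) : H →L[ℂ] H :=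
  ((1 + Complex.I) / 2) • 1 + ((1 - Complex.I) / 2) • Γ

variable {C : ComplexConj H} {p : Parity} {s σ : H →L[ℂ] H} (hs : IsSymmetry C p s)
  (hσ : IsSymmetry C p σ) (hc : Commute s σ)

include hs hσ hc

theorem star_sqrtInvolution : star (sqrtInvolution (s * σ)) =
    ((1 - Complex.I) / 2) • 1 + ((1 + Complex.I) / 2) • (s * σ) := by
  have hstar : ∀ {T : H →L[ℂ] H}, IsSymmetry C p T → star T = p.sign • T := fun {T} hT => by
    have h1 : star T * (T * T) = T := by
      rw [← mul_assoc, Unitary.star_mul_self_of_mem hT.unitary, one_mul]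
    rw [hT.square, p.square_eq, mul_smul_comm, mul_one] at h1
    conv_rhs => rw [← h1, smul_smul]
    cases p <;> simp [Parity.sign]
  have hpp : p.sign * p.sign = 1 := by cases p <;> simp [Parity.sign]
  rw [sqrtInvolution, star_add, star_smul, star_smul, star_one, star_mul, hstar hs, hstar hσ,
    smul_mul_smul_comm, hpp, one_smul, hc.eq]
  congr 2
  · simp [sub_eq_add_neg]
  · simp

/-- The involution `Γ = s σ` is real, so only the coefficients are conjugated. With `V² = Γ` this
yields `V^* C V = Γ C`: conjugation by `V` replaces `C` by `s σ C`. -/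
theorem bar_sqrtInvolution :
    C.bar (sqrtInvolution (s * σ)) = star (sqrtInvolution (s * σ)) := by
  rw [star_sqrtInvolution hs hσ hc, sqrtInvolution, bar_add, bar_smul, bar_smul, bar_one, bar_mul,
    hs.real, hσ.real]
  have h2 : starRingEnd ℂ 2 = 2 := map_ofNat _ 2
  rw [map_div₀, map_div₀, h2]
  congr 2
  · simp [sub_eq_add_neg]
  · simp

/-- Commuting symmetries of equal parity are needed: the product of their squares is then `1`. -/
theorem involution_mul_self : s * σ * (s * σ) = 1 := by
  have h1 : s * σ * (s * σ) = s * s * (σ * σ) := by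
    rw [mul_assoc, ← mul_assoc σ s, ← hc.eq, mul_assoc s σ, mul_assoc s s]
  rw [h1, hs.square, hσ.square, p.square_eq, smul_mul_smul_comm, mul_one]
  cases p <;> simp [Parity.sign]

theorem involution_mul_sqrtInvolution :
    s * σ * sqrtInvolution (s * σ) = star (sqrtInvolution (s * σ)) := by
  rw [star_sqrtInvolution hs hσ hc, sqrtInvolution, mul_add, mul_smul_comm, mul_smul_comm,
    involution_mul_self hs hσ hc, mul_one, add_comm]

theorem sqrtInvolution_mem_unitary : sqrtInvolution (s * σ) ∈ unitary (H →L[ℂ] H) := by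
  have hI := Complex.I_mul_I
  rw [Unitary.mem_iff, star_sqrtInvolution hs hσ hc, sqrtInvolution]
  constructor
  · simp only [mul_add, add_mul, smul_mul_smul_comm, involution_mul_self hs hσ hc, one_mul, mul_one]
    match_scalars <;>
      first
      | linear_combination (-1 / 2 : ℂ) * hI
      | linear_combination (1 / 2 : ℂ) * hI
  · simp only [mul_add, add_mul, smul_mul_smul_comm, involution_mul_self hs hσ hc, one_mul, mul_one]
    match_scalars <;>
      first
      | linear_combination (-1 / 2 : ℂ) * hI
      | linear_combination (1 / 2 : ℂ) * hI

omit [CompleteSpace H] hs hσ in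
theorem commute_left_sqrtInvolution : Commute s (sqrtInvolution (s * σ)) := by
  refine Commute.add_right ((Commute.one_right s).smul_right _) (Commute.smul_right ?_ _)
  exact (Commute.refl s).mul_right hc

omit [CompleteSpace H] hs hσ in
theorem commute_right_sqrtInvolution : Commute σ (sqrtInvolution (s * σ)) := by
  refine Commute.add_right ((Commute.one_right σ).smul_right _) (Commute.smul_right ?_ _)
  exact hc.symm.mul_right (Commute.refl σ)

/-- Substitute `V^* = s σ V`. Since `s² = ±1` is central and `σ` commutes with `A`, the factor `s σ`
can be moved from the right of `A` to its left. This single identity serves both the real and the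
symmetric relation. -/
theorem sqrtInvolution_conj_mul {A : H →L[ℂ] H} (hA : Commute σ A) :
    sqrtInvolution (s * σ) * A * star (sqrtInvolution (s * σ)) * s =
      s * (star (sqrtInvolution (s * σ)) * A * sqrtInvolution (s * σ)) := by
  have hVs := (commute_left_sqrtInvolution hc).eq
  have hVσ := (commute_right_sqrtInvolution hc).eq
  have hV := involution_mul_sqrtInvolution hs hσ hc
  set V := sqrtInvolution (s * σ)
  rw [← hV]
  calc V * A * (s * σ * V) * s = V * A * (s * σ * (V * s)) := by simp only [mul_assoc]
    _ = V * A * (σ * (s * s) * V) := by rw [← hVs, hc.eq]; simp only [mul_assoc]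
    _ = (σ * (s * s)) * (V * A * V) := by
      rw [hs.square, p.square_eq, mul_smul_comm, mul_one]
      simp only [smul_mul_assoc, mul_smul_comm]
      rw [mul_assoc V A, ← mul_assoc A σ V, ← hA.eq]
      simp only [← mul_assoc]
      rw [hVσ]
    _ = s * (s * σ * V * A * V) := by
      rw [← (hc.mul_left hc).eq]
      simp only [mul_assoc]

/-- Conjugation by `V` turns real operators commuting with `σ` into operators real with respect
to `s`. -/
theorem isReal_conj {A : H →L[ℂ] H} (hA : Commute σ A) (hbar : C.bar A = A) :
    IsReal C s (star (sqrtInvolution (s * σ)) * A * sqrtInvolution (s * σ)) := by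
  rw [IsReal, star_mul_mul_eq_iff hs.unitary, bar_mul, bar_mul, hbar, ← star_bar,
    bar_sqrtInvolution hs hσ hc, star_star]
  exact sqrtInvolution_conj_mul hs hσ hc hA

theorem isSymmetric_conj {A : H →L[ℂ] H} (hA : Commute σ A) (hbar : C.bar A = star A) :
    IsSymmetric C s (star (sqrtInvolution (s * σ)) * A * sqrtInvolution (s * σ)) := by
  rw [IsSymmetric, star_mul_mul_eq_iff hs.unitary, ComplexConj.transpose, bar_mul, bar_mul, hbar,
    ← star_bar, bar_sqrtInvolution hs hσ hc, star_star, star_mul, star_mul, star_star,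
    star_star, ← mul_assoc]
  exact sqrtInvolution_conj_mul hs hσ hc hA

end Twist

/-! ### Operators given by matrices -/

section MatrixOperators

variable {ι K : Type*} [Fintype ι] [DecidableEq ι] [NormedAddCommGroup K] [InnerProductSpace ℂ K]
  [CompleteSpace K] [FiniteDimensional ℂ K] (b : OrthonormalBasis ι ℂ K)

/-- The operators with given matrix in an orthonormal basis. -/
def matOp : Matrix ι ι ℂ →⋆ₐ[ℂ] (K →L[ℂ] K) :=
  (LinearMap.toMatrixOrthonormal b |>.symm.trans <|
    { LinearMap.toContinuousLinearMap with
      map_mul' := fun _ _ ↦ rfl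
      map_star' := LinearMap.adjoint_toContinuousLinearMap } :
    Matrix ι ι ℂ ≃⋆ₐ[ℂ] (K →L[ℂ] K))

theorem matOp_apply_basis (M : Matrix ι ι ℂ) (i : ι) : matOp b M (b i) = ∑ k, M k i • b k := by
  have h := Matrix.toLin_self b.toBasis b.toBasis M i
  simp only [OrthonormalBasis.coe_toBasis] at h
  exact h

theorem continuous_matOp : Continuous (matOp b) :=
  LinearMap.continuous_of_finiteDimensional
    ((matOp b : Matrix ι ι ℂ →⋆ₐ[ℂ] (K →L[ℂ] K)).toAlgHom.toLinearMap)

variable {b}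

theorem bar_matOp {D : ComplexConj K} (hD : ∀ i, D.toMap (b i) = b i) (M : Matrix ι ι ℂ) :
    D.bar (matOp b M) = matOp b (M.map (starRingEnd ℂ)) := by
  refine ContinuousLinearMap.coe_injective (b.toBasis.ext fun i => ?_)
  simp only [OrthonormalBasis.coe_toBasis, ContinuousLinearMap.coe_coe, ComplexConj.bar_apply, hD,
    matOp_apply_basis, map_sum, D.toMap.map_smulₛₗ, Matrix.map_apply]

theorem matOp_diagonal_apply_basis (g : ι → ℂ) (i : ι) :
    matOp b (Matrix.diagonal g) (b i) = g i • b i := by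
  rw [matOp_apply_basis, Finset.sum_eq_single i]
  · rw [Matrix.diagonal_apply_eq]
  · exact fun k _ hk => by rw [Matrix.diagonal_apply_ne _ hk, zero_smul]
  · exact fun h => absurd (Finset.mem_univ i) h

theorem finrank_ker_matOp_diagonal {g : ι → ℂ} {i₀ : ι} (hg : ∀ i, g i = 0 ↔ i = i₀) :
    finrank ℂ (matOp b (Matrix.diagonal g) : K →L[ℂ] K).ker = 1 := by
  have hker : (matOp b (Matrix.diagonal g) : K →L[ℂ] K).ker = Submodule.span ℂ {b i₀} := by
    apply le_antisymm
    · intro x hx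
      have hsum : ∑ i, (b.repr x i * g i) • b i = 0 := by
        rw [← LinearMap.mem_ker.mp hx]
        conv_rhs => rw [← b.sum_repr x]
        simp only [map_sum, map_smul, ContinuousLinearMap.coe_coe, matOp_diagonal_apply_basis,
          smul_smul]
      have hcoef := Fintype.linearIndependent_iff.mp b.toBasis.linearIndependent
        (fun i => b.repr x i * g i) (by simpa using hsum)
      rw [← b.sum_repr x]
      refine Submodule.sum_mem _ fun i _ => ?_
      by_cases h : i = i₀
      · exact h ▸ Submodule.smul_mem _ _ (Submodule.mem_span_singleton_self _)
      · rw [(mul_eq_zero.mp (hcoef i)).resolve_right fun h' => h ((hg i).mp h'), zero_smul]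
        exact Submodule.zero_mem _
    · rw [Submodule.span_singleton_le_iff_mem, LinearMap.mem_ker, ContinuousLinearMap.coe_coe,
        matOp_diagonal_apply_basis, (hg i₀).mpr rfl, zero_smul]
  rw [hker, finrank_span_singleton (b.orthonormal.ne_zero i₀)]

omit [FiniteDimensional ℂ K] in
theorem finrank_ker_unitary_mul {W X V : K →L[ℂ] K} (hW : W ∈ unitary (K →L[ℂ] K))
    (hV : V ∈ unitary (K →L[ℂ] K)) : finrank ℂ (W * X * V).ker = finrank ℂ X.ker := by
  let e : K ≃ₗ[ℂ] K := (Unitary.linearIsometryEquiv ⟨V, hV⟩).toLinearEquiv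
  have he : ∀ x, e x = V x := fun x => rfl
  rw [← LinearEquiv.finrank_map_eq e]
  refine congrArg (fun p : Submodule ℂ K => finrank ℂ p) ?_
  ext y
  constructor
  · rintro ⟨x, hx, rfl⟩
    have h1 : W (X (V x)) = 0 := hx
    have h2 := star_mul_apply hW (X (V x))
    rw [h1, map_zero] at h2
    exact h2.symm
  · intro hy
    have hy' : X y = 0 := hy
    refine ⟨e.symm y, ?_, e.apply_symm_apply y⟩
    change W (X (V (e.symm y))) = 0
    rw [← he, e.apply_symm_apply, hy', map_zero]

end MatrixOperators

/-! ### Tensor factors and extended blocks -/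

section Matrices

variable {m o : Type*} [Fintype m] [Fintype o] [DecidableEq m] [DecidableEq o]

/-- A matrix acting on the block index commutes with a block diagonal matrix when it only links
equal blocks. -/
theorem commute_one_kronecker_blockDiagonal {X : Matrix o o ℂ} {M : o → Matrix m m ℂ}
    (h : ∀ k l, X k l ≠ 0 → M k = M l) :
    Commute ((1 : Matrix m m ℂ) ⊗ₖ X) (Matrix.blockDiagonal M) := by
  ext ⟨i, k⟩ ⟨j, l⟩
  simp only [Matrix.mul_apply, Fintype.sum_prod_type, Matrix.kroneckerMap_apply,
    Matrix.blockDiagonal_apply, Matrix.one_apply]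
  simp only [ite_mul, mul_ite, one_mul, zero_mul, mul_zero, Finset.sum_ite_eq,
    Finset.sum_ite_eq', Finset.mem_univ, if_true]
  by_cases hX : X k l = 0
  · simp [hX]
  · simp [h k l hX, mul_comm]

/-- The operators `1 ⊗ (x ⊗ 1)`. -/
def kronFst (m : Type*) [Fintype m] [DecidableEq m] :
    Matrix (Fin 2) (Fin 2) ℂ →⋆ₐ[ℂ] Matrix (m × Fin 2 × Fin 2) (m × Fin 2 × Fin 2) ℂ where
  toFun x := (1 : Matrix m m ℂ) ⊗ₖ (x ⊗ₖ (1 : Matrix (Fin 2) (Fin 2) ℂ))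
  map_one' := by simp
  map_mul' x y := by rw [← Matrix.mul_kronecker_mul, ← Matrix.mul_kronecker_mul, one_mul, one_mul]
  map_zero' := by simp
  map_add' x y := by rw [Matrix.add_kronecker, Matrix.kronecker_add]
  commutes' r := by
    rw [Algebra.algebraMap_eq_smul_one, Matrix.smul_kronecker, Matrix.kronecker_smul,
      Matrix.one_kronecker_one, Matrix.one_kronecker_one, Algebra.algebraMap_eq_smul_one]
  map_star' x := by
    simp only [Matrix.star_eq_conjTranspose, Matrix.conjTranspose_kronecker,
      Matrix.conjTranspose_one]

/-- The operators `1 ⊗ (1 ⊗ x)`. -/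
def kronSnd (m : Type*) [Fintype m] [DecidableEq m] :
    Matrix (Fin 2) (Fin 2) ℂ →⋆ₐ[ℂ] Matrix (m × Fin 2 × Fin 2) (m × Fin 2 × Fin 2) ℂ where
  toFun x := (1 : Matrix m m ℂ) ⊗ₖ ((1 : Matrix (Fin 2) (Fin 2) ℂ) ⊗ₖ x)
  map_one' := by simp
  map_mul' x y := by rw [← Matrix.mul_kronecker_mul, ← Matrix.mul_kronecker_mul, one_mul, one_mul]
  map_zero' := by simp
  map_add' x y := by rw [Matrix.kronecker_add, Matrix.kronecker_add]
  commutes' r := by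
    rw [Algebra.algebraMap_eq_smul_one, Matrix.kronecker_smul, Matrix.kronecker_smul,
      Matrix.one_kronecker_one, Matrix.one_kronecker_one, Algebra.algebraMap_eq_smul_one]
  map_star' x := by
    simp only [Matrix.star_eq_conjTranspose, Matrix.conjTranspose_kronecker,
      Matrix.conjTranspose_one]

theorem kronFst_map_conj (x : Matrix (Fin 2) (Fin 2) ℂ) :
    (kronFst m x).map (starRingEnd ℂ) = kronFst m (x.map (starRingEnd ℂ)) := by
  ext ⟨i, k, l⟩ ⟨i', k', l'⟩
  simp [kronFst, Matrix.one_apply, apply_ite (starRingEnd ℂ)]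

theorem kronSnd_map_conj (x : Matrix (Fin 2) (Fin 2) ℂ) :
    (kronSnd m x).map (starRingEnd ℂ) = kronSnd m (x.map (starRingEnd ℂ)) := by
  ext ⟨i, k, l⟩ ⟨i', k', l'⟩
  simp [kronSnd, Matrix.one_apply, apply_ite (starRingEnd ℂ)]

theorem commute_kronFst_kronSnd (x y : Matrix (Fin 2) (Fin 2) ℂ) :
    Commute (kronFst m x) (kronSnd m y) := by
  change _ ⊗ₖ _ * _ ⊗ₖ _ = _ ⊗ₖ _ * _ ⊗ₖ _
  simp only [← Matrix.mul_kronecker_mul, one_mul, mul_one]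

/-- The block diagonal matrix with block `A` where `q = 0` and `1` elsewhere. -/
def extend (q : o → Fin 2) (A : Matrix m m ℂ) : Matrix (m × o) (m × o) ℂ :=
  Matrix.blockDiagonal fun k => if q k = 0 then A else 1

/-- The block depends only on the second two-valued index, while `x` acts on the first. So
extensions along the second index can serve as `F` and those along the first as `U`. -/
theorem commute_kronFst_extend (x : Matrix (Fin 2) (Fin 2) ℂ) (A : Matrix m m ℂ) :
    Commute (kronFst m x) (extend Prod.snd A) := by
  refine commute_one_kronecker_blockDiagonal ?_
  rintro ⟨k, k'⟩ ⟨l, l'⟩ h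
  have h' : k' = l' := by
    by_contra hne
    exact h (by simp [hne])
  simp only [h']

theorem commute_kronSnd_extend (x : Matrix (Fin 2) (Fin 2) ℂ) (A : Matrix m m ℂ) :
    Commute (kronSnd m x) (extend Prod.fst A) := by
  refine commute_one_kronecker_blockDiagonal ?_
  rintro ⟨k, k'⟩ ⟨l, l'⟩ h
  have h' : k = l := by
    by_contra hne
    exact h (by simp [hne])
  simp only [h']

theorem blockDiagonal_mem_unitary {M : o → Matrix m m ℂ}
    (h : ∀ k, M k ∈ unitary (Matrix m m ℂ)) :
    Matrix.blockDiagonal M ∈ unitary (Matrix (m × o) (m × o) ℂ) := by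
  rw [Unitary.mem_iff, Matrix.star_eq_conjTranspose, Matrix.blockDiagonal_conjTranspose,
    ← Matrix.blockDiagonal_mul, ← Matrix.blockDiagonal_mul]
  refine ⟨(congrArg _ (funext fun k => ?_)).trans Matrix.blockDiagonal_one,
    (congrArg _ (funext fun k => ?_)).trans Matrix.blockDiagonal_one⟩
  · exact Unitary.star_mul_self_of_mem (h k)
  · exact Unitary.mul_star_self_of_mem (h k)

theorem extend_mem_unitary (q : o → Fin 2) {A : Matrix m m ℂ} (h : A ∈ unitary (Matrix m m ℂ)) :
    extend q A ∈ unitary (Matrix (m × o) (m × o) ℂ) := by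
  refine blockDiagonal_mem_unitary fun k => ?_
  split_ifs
  exacts [h, one_mem _]

omit [Fintype m] [Fintype o] in
theorem extend_one (q : o → Fin 2) : extend q (1 : Matrix m m ℂ) = 1 := by
  simp only [extend, ite_self]
  exact Matrix.blockDiagonal_one

omit [Fintype m] [Fintype o] in
theorem extend_map_conj (q : o → Fin 2) (A : Matrix m m ℂ) :
    (extend q A).map (starRingEnd ℂ) = extend q (A.map (starRingEnd ℂ)) := by
  rw [extend, Matrix.blockDiagonal_map _ _ (map_zero _), extend]
  congr 1
  funext k
  split_ifs
  · rfl
  · exact Matrix.map_one _ (map_zero _) (map_one _)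

omit [Fintype m] [Fintype o] in
theorem star_extend (q : o → Fin 2) (A : Matrix m m ℂ) : star (extend q A) = extend q (star A) := by
  rw [extend, Matrix.star_eq_conjTranspose, Matrix.blockDiagonal_conjTranspose, extend]
  congr 1
  funext k
  split_ifs
  · rfl
  · exact Matrix.conjTranspose_one

omit [Fintype m] [Fintype o] in
theorem continuous_extend (q : o → Fin 2) :
    Continuous (extend q : Matrix m m ℂ → Matrix (m × o) (m × o) ℂ) := by
  refine Continuous.matrix_blockDiagonal (continuous_pi fun k => ?_)
  split_ifs
  exacts [continuous_id, continuous_const]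

/-- If the anticommutator of `A` and `B` is `c D`, that of their extensions is, up to a unitary
factor, the extension of `D` by `2`. -/
theorem exists_anticommutator_extend {A B c : Matrix m m ℂ} {D : m → ℂ}
    (hA : A ∈ unitary (Matrix m m ℂ)) (hB : B ∈ unitary (Matrix m m ℂ))
    (hc : c ∈ unitary (Matrix m m ℂ)) (h : B * A + A * B = c * Matrix.diagonal D) :
    ∃ L ∈ unitary (Matrix (m × Fin 2 × Fin 2) (m × Fin 2 × Fin 2) ℂ),
      extend Prod.snd B * extend Prod.fst A + extend Prod.fst A * extend Prod.snd B =
        L * Matrix.diagonal fun i => if i.2 = 0 then D i.1 else 2 := by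
  -- Of the four blocks, only the one at `(0, 0)` sees both `A` and `B`; the others are `2 A`, `2 B`
  -- and `2`, all invertible. Tensoring with the identity would instead multiply the kernel
  -- dimension by four.
  refine ⟨Matrix.blockDiagonal fun k => if k.1 = 0 then (if k.2 = 0 then c else A) else
    if k.2 = 0 then B else 1, blockDiagonal_mem_unitary fun k => ?_, ?_⟩
  · split_ifs
    exacts [hc, hA, hB, one_mem _]
  · rw [← Matrix.blockDiagonal_diagonal (fun (k : Fin 2 × Fin 2) i => if k = 0 then D i else 2),
      ← Matrix.blockDiagonal_mul, extend, extend, ← Matrix.blockDiagonal_mul,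
      ← Matrix.blockDiagonal_mul, ← Matrix.blockDiagonal_add]
    congr 1
    funext k
    have h2 : (Matrix.diagonal fun _ : m => (2 : ℂ)) = 1 + 1 := by
      rw [one_add_one_eq_two]
      rfl
    obtain ⟨k, l⟩ := k
    by_cases hk : k = 0 <;> by_cases hl : l = 0 <;>
      simp [hk, hl, h, h2, mul_add]

end Matrices

/-! ### Paths of `3 × 3` unitaries -/

section Paths

/-- A cyclic permutation matrix. -/
def cyclic : Matrix (Fin 3) (Fin 3) ℂ := !![0, 0, 1; 1, 0, 0; 0, 1, 0]

/-- The diagonal matrix with entries `1`, `z²`, `z`. -/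
def phases (z : ℂ) : Matrix (Fin 3) (Fin 3) ℂ := Matrix.diagonal ![1, z ^ 2, z]

theorem cyclic_mem_unitary : cyclic ∈ unitary (Matrix (Fin 3) (Fin 3) ℂ) := by
  rw [Unitary.mem_iff]
  constructor <;> ext i j <;> fin_cases i <;> fin_cases j <;>
    simp [cyclic, Matrix.mul_apply, Fin.sum_univ_three, Matrix.star_apply]

theorem cyclic_map_conj : cyclic.map (starRingEnd ℂ) = cyclic := by
  ext i j
  fin_cases i <;> fin_cases j <;> simp [cyclic]

theorem star_phases (z : ℂ) : star (phases z) = phases (starRingEnd ℂ z) := by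
  rw [phases, Matrix.star_eq_conjTranspose, Matrix.diagonal_conjTranspose, phases]
  congr 1
  funext i
  fin_cases i <;> simp

theorem phases_map_conj (z : ℂ) : (phases z).map (starRingEnd ℂ) = star (phases z) := by
  rw [star_phases, phases, Matrix.diagonal_map (map_zero _), phases]
  congr 1
  funext i
  fin_cases i <;> simp

theorem phases_mul (z w : ℂ) : phases z * phases w = phases (z * w) := by
  rw [phases, phases, Matrix.diagonal_mul_diagonal, phases]
  congr 1
  funext i
  fin_cases i <;> simp [mul_pow]

theorem phases_one : phases 1 = 1 := by
  rw [phases, ← Matrix.diagonal_one]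
  congr 1
  funext i
  fin_cases i <;> simp

theorem phases_mem_unitary {z : ℂ} (hz : starRingEnd ℂ z * z = 1) :
    phases z ∈ unitary (Matrix (Fin 3) (Fin 3) ℂ) := by
  rw [Unitary.mem_iff, star_phases, phases_mul, phases_mul, mul_comm z, hz, phases_one]
  exact ⟨rfl, rfl⟩

theorem phases_I_mem_unitary : phases Complex.I ∈ unitary (Matrix (Fin 3) (Fin 3) ℂ) :=
  phases_mem_unitary (by simp)

/-- The diagonal factor consists of sums of cyclically consecutive entries of `(1, -1, i)`; exactly
one of them, `1 + (-1)`, vanishes. -/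
theorem phases_mul_cyclic_add : phases Complex.I * cyclic + cyclic * phases Complex.I =
    cyclic * Matrix.diagonal ![0, -1 + Complex.I, 1 + Complex.I] := by
  ext i j
  rw [phases, Matrix.add_apply, Matrix.diagonal_mul, Matrix.mul_diagonal, Matrix.mul_diagonal]
  fin_cases i <;> fin_cases j <;> simp [cyclic, add_comm]

theorem exists_symmetric_path : ∃ B : unitInterval → Matrix (Fin 3) (Fin 3) ℂ, Continuous B ∧
    B 0 = 1 ∧ B 1 = phases Complex.I ∧
    ∀ t, B t ∈ unitary (Matrix (Fin 3) (Fin 3) ℂ) ∧ (B t).map (starRingEnd ℂ) = star (B t) := by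
  refine ⟨fun t => phases (Complex.exp (((t : ℝ) * (Real.pi / 2) : ℝ) * Complex.I)), ?_, ?_, ?_,
    fun t => ⟨phases_mem_unitary ?_, phases_map_conj _⟩⟩
  · refine Continuous.matrix_diagonal (continuous_pi fun i => ?_)
    fin_cases i
    · exact continuous_const
    · exact (by fun_prop : Continuous fun t : unitInterval =>
        Complex.exp (((t : ℝ) * (Real.pi / 2) : ℝ) * Complex.I) ^ 2)
    · exact (by fun_prop : Continuous fun t : unitInterval =>
        Complex.exp (((t : ℝ) * (Real.pi / 2) : ℝ) * Complex.I))
  · simp [phases_one]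
  · simp [Complex.exp_pi_div_two_mul_I]
  · rw [← Complex.normSq_eq_conj_mul_self, Complex.normSq_eq_norm_sq,
      Complex.norm_exp_ofReal_mul_I]
    simp

/-- The circulant matrix with entries `1 - t`, `t`, `-t (1 - t)`. -/
def circulant (t : ℂ) : Matrix (Fin 3) (Fin 3) ℂ :=
  !![1 - t, -(t * (1 - t)), t; t, 1 - t, -(t * (1 - t)); -(t * (1 - t)), t, 1 - t]

/-- A 3-cycle is an even permutation, so it lies in the connected group `SO(3)`; a path of
normalized circulants makes this explicit. -/
theorem exists_real_path : ∃ B : unitInterval → Matrix (Fin 3) (Fin 3) ℂ, Continuous B ∧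
    B 0 = 1 ∧ B 1 = cyclic ∧
    ∀ t, B t ∈ unitary (Matrix (Fin 3) (Fin 3) ℂ) ∧ (B t).map (starRingEnd ℂ) = B t := by
  have hw : ∀ t : ℝ, ((1 - t + t ^ 2 : ℝ) : ℂ) ≠ 0 := fun t => by
    rw [Complex.ofReal_ne_zero]
    nlinarith [sq_nonneg (t - 1 / 2)]
  have hreal : ∀ t : ℝ, (circulant t).map (starRingEnd ℂ) = circulant t := fun t => by
    ext i j
    fin_cases i <;> fin_cases j <;> simp [circulant]
  -- The entries `a, b, c` satisfy `a + b + c = 1 - t + t²` and `a b + b c + c a = 0`, so the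
  -- columns are orthogonal, with `a² + b² + c² = (1 - t + t²)²`.
  have hmul : ∀ t : ℂ, (circulant t).transpose * circulant t = ((1 - t + t ^ 2) ^ 2) • 1 :=
      fun t => by
    ext i j
    fin_cases i <;> fin_cases j <;>
      simp [circulant, Matrix.mul_apply, Fin.sum_univ_three] <;> ring
  have hstar : ∀ t : ℝ, star (circulant t) = (circulant t).transpose := fun t => by
    conv_rhs => rw [← hreal t]
    rfl
  refine ⟨fun t => ((1 - t + t ^ 2 : ℝ) : ℂ)⁻¹ • circulant (t : ℝ), ?_, ?_, ?_, fun t => ⟨?_, ?_⟩⟩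
  · have h1 : Continuous fun t : unitInterval => ((1 - t + t ^ 2 : ℝ) : ℂ)⁻¹ :=
      Continuous.inv₀ (by fun_prop) fun t => hw t
    have h2 : Continuous fun t : unitInterval => circulant (t : ℝ) := by
      refine continuous_matrix fun i j => ?_
      fin_cases i <;> fin_cases j <;> simp [circulant] <;> fun_prop
    exact h1.smul h2
  · ext i j
    fin_cases i <;> fin_cases j <;> simp [circulant]
  · ext i j
    fin_cases i <;> fin_cases j <;> simp [circulant, cyclic]
  · have h1 : star (((1 - t + t ^ 2 : ℝ) : ℂ)⁻¹ • circulant (t : ℝ)) *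
        (((1 - t + t ^ 2 : ℝ) : ℂ)⁻¹ • circulant (t : ℝ)) = 1 := by
      rw [star_smul, hstar, smul_mul_smul_comm, hmul, smul_smul, star_inv₀, Complex.star_def,
        Complex.conj_ofReal]
      have := hw t
      convert one_smul ℂ (1 : Matrix (Fin 3) (Fin 3) ℂ)
      push_cast at this ⊢
      field_simp
    exact Unitary.mem_iff.mpr ⟨h1, mul_eq_one_comm.mp h1⟩
  · ext i j
    have := congrFun (congrFun (hreal t) i) j
    rw [Matrix.map_apply] at this
    change starRingEnd ℂ (((1 - t + t ^ 2 : ℝ) : ℂ)⁻¹ * circulant (t : ℝ) i j) =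
      ((1 - t + t ^ 2 : ℝ) : ℂ)⁻¹ * circulant (t : ℝ) i j
    rw [map_mul, this, map_inv₀, Complex.conj_ofReal]

end Paths

/-! ### The twelve-dimensional model -/

section Model

variable {K : Type*} [NormedAddCommGroup K] [InnerProductSpace ℂ K] [CompleteSpace K]
  [FiniteDimensional ℂ K] (b : OrthonormalBasis (Fin 3 × Fin 2 × Fin 2) ℂ K)

/-- The operators acting on the first two-dimensional factor. -/
def opFst : Matrix (Fin 2) (Fin 2) ℂ →⋆ₐ[ℂ] (K →L[ℂ] K) := (matOp b).comp (kronFst (Fin 3))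

/-- The operators acting on the second two-dimensional factor. -/
def opSnd : Matrix (Fin 2) (Fin 2) ℂ →⋆ₐ[ℂ] (K →L[ℂ] K) := (matOp b).comp (kronSnd (Fin 3))

/-- The extension of `A` along `q`, conjugated by `V`. -/
def twisted (V : K →L[ℂ] K) (q : Fin 2 × Fin 2 → Fin 2) (A : Matrix (Fin 3) (Fin 3) ℂ) :
    K →L[ℂ] K :=
  star V * matOp b (extend q A) * V

variable {b}

theorem bar_opFst {D : ComplexConj K} (hD : ∀ i, D.toMap (b i) = b i)
    (x : Matrix (Fin 2) (Fin 2) ℂ) : D.bar (opFst b x) = opFst b (x.map (starRingEnd ℂ)) :=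
  (bar_matOp hD _).trans (congrArg _ (kronFst_map_conj x))

theorem bar_opSnd {D : ComplexConj K} (hD : ∀ i, D.toMap (b i) = b i)
    (x : Matrix (Fin 2) (Fin 2) ℂ) : D.bar (opSnd b x) = opSnd b (x.map (starRingEnd ℂ)) :=
  (bar_matOp hD _).trans (congrArg _ (kronSnd_map_conj x))

theorem commute_opFst_opSnd (x y : Matrix (Fin 2) (Fin 2) ℂ) : Commute (opFst b x) (opSnd b y) :=
  (commute_kronFst_kronSnd x y).map (matOp b)

theorem commute_opFst_extend (x : Matrix (Fin 2) (Fin 2) ℂ) (A : Matrix (Fin 3) (Fin 3) ℂ) :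
    Commute (opFst b x) (matOp b (extend Prod.snd A)) :=
  (commute_kronFst_extend x A).map (matOp b)

theorem commute_opSnd_extend (x : Matrix (Fin 2) (Fin 2) ℂ) (A : Matrix (Fin 3) (Fin 3) ℂ) :
    Commute (opSnd b x) (matOp b (extend Prod.fst A)) :=
  (commute_kronSnd_extend x A).map (matOp b)

theorem matOp_mem_unitary {M : Matrix (Fin 3 × Fin 2 × Fin 2) (Fin 3 × Fin 2 × Fin 2) ℂ}
    (h : M ∈ unitary (Matrix (Fin 3 × Fin 2 × Fin 2) (Fin 3 × Fin 2 × Fin 2) ℂ)) :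
    matOp b M ∈ unitary (K →L[ℂ] K) := by
  rw [Unitary.mem_iff, ← map_star, ← map_mul, ← map_mul, Unitary.star_mul_self_of_mem h,
    Unitary.mul_star_self_of_mem h, map_one]
  exact ⟨rfl, rfl⟩

variable {V : K →L[ℂ] K}

theorem twisted_mem_unitary (hV : V ∈ unitary (K →L[ℂ] K)) (q : Fin 2 × Fin 2 → Fin 2)
    {A : Matrix (Fin 3) (Fin 3) ℂ} (hA : A ∈ unitary (Matrix (Fin 3) (Fin 3) ℂ)) :
    twisted b V q A ∈ unitary (K →L[ℂ] K) :=
  mul_mem (mul_mem (Unitary.star_mem hV) (matOp_mem_unitary (extend_mem_unitary q hA))) hV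

theorem twisted_one (hV : V ∈ unitary (K →L[ℂ] K)) (q : Fin 2 × Fin 2 → Fin 2) :
    twisted b V q 1 = 1 := by
  rw [twisted, extend_one, map_one, mul_one, Unitary.star_mul_self_of_mem hV]

theorem continuous_twisted (q : Fin 2 × Fin 2 → Fin 2) : Continuous (twisted b V q) :=
  (continuous_const.mul ((continuous_matOp b).comp (continuous_extend q))).mul continuous_const

/-- Unitary factors do not affect the kernel dimension, and the remaining diagonal matrix vanishes
only at `(i₀, 0)`. -/
theorem finrank_ker_anticomm_twisted (hV : V ∈ unitary (K →L[ℂ] K))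
    {A B c : Matrix (Fin 3) (Fin 3) ℂ} {D : Fin 3 → ℂ}
    (hA : A ∈ unitary (Matrix (Fin 3) (Fin 3) ℂ)) (hB : B ∈ unitary (Matrix (Fin 3) (Fin 3) ℂ))
    (hc : c ∈ unitary (Matrix (Fin 3) (Fin 3) ℂ)) (h : B * A + A * B = c * Matrix.diagonal D)
    {i₀ : Fin 3} (hD : ∀ i, D i = 0 ↔ i = i₀) :
    finrank ℂ (anticomm (twisted b V Prod.fst A) (twisted b V Prod.snd B)).ker = 1 := by
  obtain ⟨L, hL, hLg⟩ := exists_anticommutator_extend hA hB hc h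
  have h1 : ∀ X Y : K →L[ℂ] K, star V * X * V * (star V * Y * V) = star V * (X * Y) * V :=
    fun X Y => by
      rw [mul_assoc _ V, ← mul_assoc V, ← mul_assoc V, Unitary.mul_star_self_of_mem hV, one_mul]
      simp only [mul_assoc]
  have h2 : anticomm (twisted b V Prod.fst A) (twisted b V Prod.snd B) =
      star V * matOp b L * matOp b (Matrix.diagonal fun i => if i.2 = 0 then D i.1 else 2) * V := by
    rw [anticomm, twisted, twisted, h1, h1, ← add_mul, ← mul_add, ← map_mul, ← map_mul, ← map_add,
      hLg, map_mul, mul_assoc (star V) (matOp b L)]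
  rw [h2, finrank_ker_unitary_mul (mul_mem (Unitary.star_mem hV) (matOp_mem_unitary hL)) hV]
  refine finrank_ker_matOp_diagonal (i₀ := (i₀, 0)) ?_
  rintro ⟨i, k⟩
  by_cases hk : k = 0
  · simp [hk, hD]
  · simp [hk]

end Model

/-! ### Symmetry relations of the model -/

section Twisted

variable {K : Type*} [NormedAddCommGroup K] [InnerProductSpace ℂ K] [CompleteSpace K]
  [FiniteDimensional ℂ K] {b : OrthonormalBasis (Fin 3 × Fin 2 × Fin 2) ℂ K}
  {D : ComplexConj K} (hD : ∀ i, D.toMap (b i) = b i) (q : Fin 2 × Fin 2 → Fin 2)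
  {A : Matrix (Fin 3) (Fin 3) ℂ} {p : Parity} {s σ : K →L[ℂ] K} (hs : IsSymmetry D p s)
  (hσ : IsSymmetry D p σ) (hc : Commute s σ) (hA : Commute σ (matOp b (extend q A)))

include hD hs hσ hc hA

theorem isReal_twisted (h : A.map (starRingEnd ℂ) = A) :
    IsReal D s (twisted b (sqrtInvolution (s * σ)) q A) :=
  isReal_conj hs hσ hc hA (by rw [bar_matOp hD, extend_map_conj, h])

theorem isSymmetric_twisted (h : A.map (starRingEnd ℂ) = star A) :
    IsSymmetric D s (twisted b (sqrtInvolution (s * σ)) q A) :=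
  isSymmetric_conj hs hσ hc hA (by rw [bar_matOp hD, extend_map_conj, h, ← star_extend, map_star])

end Twisted

/-! ### Trivialization at the zero entries -/

section Trivialization

variable {H K : Type*} [NormedAddCommGroup H] [InnerProductSpace ℂ H] [CompleteSpace H]
  [NormedAddCommGroup K] [InnerProductSpace ℂ K] [CompleteSpace K] [FiniteDimensional ℂ K]

/-- A real symmetric pairing with odd index can be trivialized by a path of pairings on a
twelve-dimensional space. -/
theorem IsPairing.exists_path_of_index₂_ne_zero {C : ComplexConj H} {D : ComplexConj K}
    {b : OrthonormalBasis (Fin 3 × Fin 2 × Fin 2) ℂ K} (hD : ∀ i, D.toMap (b i) = b i)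
    {j : Row} {d : Col} {S Sig U F : H →L[ℂ] H} (h : IsPairing C j d S Sig U F)
    (h0 : index₂ (pairingOp U F) ≠ 0)
    (hjd : j = .j1 ∧ d = .d2 ∨ j = .j5 ∧ d = .d6 ∨ j = .j3 ∧ d = .d4 ∨ j = .j7 ∧ d = .d8) :
    ∃ (s sig u : K →L[ℂ] K)
      (γ : C(unitInterval, (DSum H K →L[ℂ] DSum H K) × (DSum H K →L[ℂ] DSum H K))),
      γ 0 = (FUPairing.diagOp U u, FUPairing.diagOp F 1) ∧
      (∀ t, IsPairing (C.sum D) j d (FUPairing.diagOp S s) (FUPairing.diagOp Sig sig)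
        (γ t).1 (γ t).2) ∧
      index₂ (pairingOp (γ 1).1 (γ 1).2) = 0 := by
  have : Nontrivial H := by
    by_contra hn
    have := not_nontrivial_iff_subsingleton.mp hn
    exact h0 (by rw [index₂_pairingOp h.unitary_U, finrank_zero_of_subsingleton, Nat.cast_zero])
  -- Equal parities mean `J² = 1`, and make `s σ` an involution.
  have hpar : d.parity = j.parity := by
    rcases hjd with ⟨rfl, rfl⟩ | ⟨rfl, rfl⟩ | ⟨rfl, rfl⟩ | ⟨rfl, rfl⟩ <;> rfl
  obtain ⟨x, hs, hSs⟩ := h.symm_S.exists_augmentation D (opFst b) (bar_opFst hD)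
  obtain ⟨y, hσ, hSσ⟩ := h.symm_Sig.exists_augmentation D (opSnd b) (bar_opSnd hD)
  have hσ' := hpar ▸ hσ
  have hc := commute_opFst_opSnd (b := b) x y
  have hV := sqrtInvolution_mem_unitary hs hσ' hc
  have hVs := commute_left_sqrtInvolution hc
  have hVσ := commute_right_sqrtInvolution hc
  have hrealU := fun A => isReal_twisted hD Prod.fst hs hσ' hc (commute_opSnd_extend (b := b) y A)
  have hsymU := fun A =>
    isSymmetric_twisted hD Prod.fst hs hσ' hc (commute_opSnd_extend (b := b) y A)
  have hrealF := fun A =>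
    isReal_twisted hD Prod.snd hσ' hs hc.symm (commute_opFst_extend (b := b) x A)
  have hsymF := fun A =>
    isSymmetric_twisted hD Prod.snd hσ' hs hc.symm (commute_opFst_extend (b := b) x A)
  -- The relations for `F` come with the roles of `s` and `σ` exchanged; since these commute, the
  -- same square root `V` serves for both unitaries.
  rw [← hc.eq] at hrealF hsymF
  set s := opFst b x
  set σ := opSnd b y
  set V := sqrtInvolution (s * σ)
  obtain ⟨A, B, hA, hBcont, hB0, hB, hUrel, hFrel, hker⟩ :
      ∃ (A : Matrix (Fin 3) (Fin 3) ℂ) (B : unitInterval → Matrix (Fin 3) (Fin 3) ℂ),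
        A ∈ unitary (Matrix (Fin 3) (Fin 3) ℂ) ∧ Continuous B ∧ B 0 = 1 ∧
        (∀ t, B t ∈ unitary (Matrix (Fin 3) (Fin 3) ℂ)) ∧
        j.Rel D s (twisted b V Prod.fst A) ∧ (∀ t, d.Rel D σ (twisted b V Prod.snd (B t))) ∧
        finrank ℂ (anticomm (twisted b V Prod.fst A) (twisted b V Prod.snd (B 1))).ker = 1 := by
    have hzero : ∀ i : Fin 3,
        (![0, -1 + Complex.I, 1 + Complex.I] : Fin 3 → ℂ) i = 0 ↔ i = 0 := fun i => by
      fin_cases i <;> simp [Complex.ext_iff]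
    have hφ : (phases Complex.I).map (starRingEnd ℂ) = star (phases Complex.I) :=
      phases_map_conj _
    obtain ⟨Bs, hs1, hs2, hs3, hs4⟩ := exists_symmetric_path
    obtain ⟨Br, hr1, hr2, hr3, hr4⟩ := exists_real_path
    have hkers : finrank ℂ
        (anticomm (twisted b V Prod.fst cyclic) (twisted b V Prod.snd (Bs 1))).ker = 1 := by
      rw [hs3]
      exact finrank_ker_anticomm_twisted hV cyclic_mem_unitary phases_I_mem_unitary
        cyclic_mem_unitary phases_mul_cyclic_add hzero
    have hkerr : finrank ℂ
        (anticomm (twisted b V Prod.fst (phases Complex.I))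
          (twisted b V Prod.snd (Br 1))).ker = 1 := by
      rw [hr3]
      exact finrank_ker_anticomm_twisted hV phases_I_mem_unitary cyclic_mem_unitary
        cyclic_mem_unitary ((add_comm _ _).trans phases_mul_cyclic_add) hzero
    -- The real unitary is modelled on the 3-cycle and the symmetric one on the phases; whichever
    -- plays the role of `F` is deformed from `1`.
    rcases hjd with ⟨rfl, rfl⟩ | ⟨rfl, rfl⟩ | ⟨rfl, rfl⟩ | ⟨rfl, rfl⟩
    · exact ⟨cyclic, Bs, cyclic_mem_unitary, hs1, hs2, fun t => (hs4 t).1,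
        hrealU _ cyclic_map_conj, fun t => hsymF _ (hs4 t).2, hkers⟩
    · exact ⟨cyclic, Bs, cyclic_mem_unitary, hs1, hs2, fun t => (hs4 t).1,
        hrealU _ cyclic_map_conj, fun t => hsymF _ (hs4 t).2, hkers⟩
    · exact ⟨phases Complex.I, Br, phases_I_mem_unitary, hr1, hr2, fun t => (hr4 t).1,
        hsymU _ hφ, fun t => hrealF _ (hr4 t).2, hkerr⟩
    · exact ⟨phases Complex.I, Br, phases_I_mem_unitary, hr1, hr2, fun t => (hr4 t).1,
        hsymU _ hφ, fun t => hrealF _ (hr4 t).2, hkerr⟩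
  have hu := twisted_mem_unitary (b := b) hV Prod.fst hA
  have hp : ∀ t, IsPairing D j d s σ (twisted b V Prod.fst A) (twisted b V Prod.snd (B t)) :=
    fun t =>
    { unitary_U := hu
      unitary_F := twisted_mem_unitary hV Prod.snd (hB t)
      symm_S := hs
      symm_Sig := hσ
      rel_S := hUrel
      rel_Sig := hFrel t
      comm_S_Sig := hc
      comm_S_F := ((commute_star_of_mem_unitary hV hVs).mul_right
        (commute_opFst_extend x _)).mul_right hVs
      comm_Sig_P := (commute_diagOp_doubledProj_iff hu).mpr
        (((commute_star_of_mem_unitary hV hVσ).mul_right (commute_opSnd_extend y _)).mul_right hVσ)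
      fredholm := isFredholm_of_finiteDimensional _ }
  refine ⟨s, σ, twisted b V Prod.fst A, h.exists_path (fun t => twisted b V Prod.snd (B t))
    ((continuous_twisted _).comp hBcont) (by rw [hB0, twisted_one hV]) hp hSs hSσ ?_⟩
  -- Both indices are odd, so their sum vanishes in `ZMod 2`.
  rw [index₂_pairingOp hu, hker, Nat.cast_one]
  revert h0
  generalize index₂ (pairingOp U F) = a
  decide +revert

omit [CompleteSpace K] [FiniteDimensional ℂ K] in
theorem IsPairing.isTrivializable {C : ComplexConj H} {j : Row} {d : Col} {S Sig U F : H →L[ℂ] H}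
    (h : IsPairing C j d S Sig U F) (he : entry j d = none) : IsTrivializable C j d S Sig U F := by
  by_cases h0 : index₂ (pairingOp U F) = 0
  · exact h.isTrivializable_of_index₂_eq_zero h0
  · let e : Fin 12 ≃ Fin 3 × Fin 2 × Fin 2 := Fintype.equivOfCardEq (by simp)
    -- The reindexed standard basis is fixed by the conjugation, so conjugating an operator
    -- conjugates its matrix entrywise.
    have hD : ∀ i, (stdConj 12).toMap (((EuclideanSpace.basisFun (Fin 12) ℂ).reindex e) i) =
        ((EuclideanSpace.basisFun (Fin 12) ℂ).reindex e) i := fun i => by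
      ext k
      rw [OrthonormalBasis.reindex_apply, EuclideanSpace.basisFun_apply]
      change starRingEnd ℂ _ = _
      rw [PiLp.single_apply]
      split_ifs <;> simp
    exact ⟨12, h.exists_path_of_index₂_ne_zero hD h0 ((h.index₂_eq_zero_or he).resolve_left h0)⟩

end Trivialization

end FUPairing

end

theorem mainTheorem4 {H : Type*} [NormedAddCommGroup H] [InnerProductSpace ℂ H] [CompleteSpace H]
    (C : FUPairing.ComplexConj H) (j : FUPairing.Row) (d : FUPairing.Col)
    (S Sig U F : H →L[ℂ] H) (h : FUPairing.IsPairing C j d S Sig U F) :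
    FUPairing.noetherIndex (FUPairing.pairingOp U F) = 0 ∧
    (∀ τ : FUPairing.IndexType, FUPairing.entry j d = some τ →
      FUPairing.HasType (C.sum C) τ (FUPairing.diagOp Sig Sig) (FUPairing.doubledProj U)
        (FUPairing.diagOp F F) ∧
      FUPairing.IsWellDefined C j d S Sig U F) ∧
    (FUPairing.entry j d = none → FUPairing.IsTrivializable C j d S Sig U F) :=
  ⟨FUPairing.noetherIndex_pairingOp h.unitary_U h.unitary_F,
    fun _ hτ => ⟨h.hasType hτ, h.isWellDefined hτ⟩, h.isTrivializable⟩
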